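/- Let $k$ be a field, let $n,m\ge 1$ be integers, let $S=k[y_1,\dots,y_n]$ with the standard grading, and let $$J=J_{n,m}=\langle y_1^m,\dots,y_n^m\rangle+\langle y_1^{m-a}y_j^{a} : 2\le j\le n,\ 1\le a\le m-1\rangle\subseteq S .$$ For a finitely generated graded $S$-module $M$, let $\beta_i(M)$ be the rank of the $i$-th module, and $\beta_{i,e}(M)$ the number of basis elements of degree $e$ of the $i$-th module, in a minimal graded free resolution of $M$; the Castelnuovo–Mumford regularity of $M$ is $\operatorname{reg}(M)=\max\{e-i : \beta_{i,e}(M)\ne 0\}$. Then: 1. $\beta_0(J)=n+(n-1)(m-1)$, and for all $1\le i\le n-1$ $$\beta_i(J)=\binom{n-1}{i}+\sum_{j=2}^{n}(m-1)\binom{1+n-j}{i}+\binom{n-1}{i+1}.$$ 2. The projective dimension of the $S$-module $J$ is $n-1$. 3. If $n\ge 2$, then $\operatorname{reg}(S/J)=(n-1)(m-1)$ and $\operatorname{reg}(J)=(n-1)(m-1)+1$. 4. The minimal graded free resolution of $J$ can be obtained as an iterated mapping cone resolution. Here iterated mapping cone resolutions of monomial ideals are defined recursively: the zero ideal has the zero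 complex; if $I$ has minimal monomial generators $g_1,\dots,g_r$ (in some order), $I'=\langle g_1,\dots,g_{r-1}\rangle$ and $\tilde I=I'\cap\langle g_r\rangle$, and if $F'$ and $\tilde F$ are iterated mapping cone resolutions of $I'$ and $\tilde I$, then the mapping cone of any degree-preserving chain map $\tilde F\to F'\oplus S(-\deg g_r)$ lifting the inclusion $\tilde I\to I'\oplus\langle g_r\rangle$, $z\mapsto(z,-z)$, is an iterated mapping cone resolution of $I$. -/

import Mathlib

open MvPolynomial

universe u v

namespace GradedRes

/-- An element `x = ∑_b x_b e_b` of the free module `⨁_b S(-deg b)` over the polynomial ring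
`S = k[y_1, …, y_n]` is homogeneous of degree `e`: every monomial `y^u` occurring in the
coefficient of `e_b` satisfies `|u| + deg b = e` (so `0` is homogeneous of every degree). -/
def IsHomog {k : Type u} [Field k] {n : ℕ} {ι : Type} (deg : ι → ℕ) (e : ℕ)
    (x : ι →₀ MvPolynomial (Fin n) k) : Prop :=
  ∀ b : ι, ∀ w ∈ (x b).support, w.degree + deg b = e

/-- A complex `⋯ → F_2 → F_1 → F_0` of finitely generated graded free modules over
`S = k[y_1, …, y_n]`. The module `F_i` has the finite basis `ι i`, with the basis element `b`
placed in degree `deg i b`, i.e. `F_i = ⨁_b S(-deg i b)`; the differentials preserve degrees. -/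
structure FreeComplex (k : Type u) [Field k] (n : ℕ) where
  ι : ℕ → Type
  fin : ∀ i, Finite (ι i)
  deg : ∀ i, ι i → ℕ
  d : ∀ i, (ι (i + 1) →₀ MvPolynomial (Fin n) k) →ₗ[MvPolynomial (Fin n) k]
    (ι i →₀ MvPolynomial (Fin n) k)
  d_comp_d : ∀ i, d i ∘ₗ d (i + 1) = 0
  d_homog : ∀ i (b : ι (i + 1)), IsHomog (deg i) (deg (i + 1) b) (d i (Finsupp.single b 1))

namespace FreeComplex

variable {k : Type u} [Field k] {n : ℕ}

/-- The `i`-th module `F_i` of the complex. -/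
abbrev obj (F : FreeComplex k n) (i : ℕ) : Type u := F.ι i →₀ MvPolynomial (Fin n) k

/-- The rank of the free module `F_i`. -/
noncomputable def rank (F : FreeComplex k n) (i : ℕ) : ℕ := Nat.card (F.ι i)

/-- A complex of graded free modules is minimal if `d(F_{i+1}) ⊆ 𝔪 F_i` for all `i`,
where `𝔪 = ⟨y_1, …, y_n⟩`. -/
def IsMinimal (F : FreeComplex k n) : Prop :=
  ∀ i, LinearMap.range (F.d i) ≤
    (Ideal.span (Set.range (X : Fin n → MvPolynomial (Fin n) k))) •
      (⊤ : Submodule (MvPolynomial (Fin n) k) (F.obj i))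

/-- Morphisms of complexes of graded free modules (chain maps preserving degrees). -/
structure Hom (F G : FreeComplex k n) where
  f : ∀ i, F.obj i →ₗ[MvPolynomial (Fin n) k] G.obj i
  comm : ∀ i, G.d i ∘ₗ f (i + 1) = f i ∘ₗ F.d i
  f_homog : ∀ i (b : F.ι i), IsHomog (G.deg i) (F.deg i b) (f i (Finsupp.single b 1))

/-- The identification `S^(α ⊕ β) = S^α × S^β`. -/
noncomputable abbrev sumEquiv (k : Type u) [Field k] (n : ℕ) (α β : Type) :
    (α ⊕ β →₀ MvPolynomial (Fin n) k) ≃ₗ[MvPolynomial (Fin n) k]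
      (α →₀ MvPolynomial (Fin n) k) × (β →₀ MvPolynomial (Fin n) k) :=
  Finsupp.sumFinsuppLEquivProdFinsupp (MvPolynomial (Fin n) k)

theorem sumEquiv_single_inl {α β : Type} (b : α) (r : MvPolynomial (Fin n) k) :
    sumEquiv k n α β (Finsupp.single (Sum.inl b) r) = (Finsupp.single b r, 0) := by
  classical
  ext c : 2 <;> simp [sumEquiv, Finsupp.single_apply]

theorem sumEquiv_single_inr {α β : Type} (b : β) (r : MvPolynomial (Fin n) k) :
    sumEquiv k n α β (Finsupp.single (Sum.inr b) r) = (0, Finsupp.single b r) := by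
  classical
  ext c : 2 <;> simp [sumEquiv, Finsupp.single_apply]

theorem isHomog_sumEquiv_symm {α β : Type} {deg₁ : α → ℕ} {deg₂ : β → ℕ} {e : ℕ}
    {x : α →₀ MvPolynomial (Fin n) k} {y : β →₀ MvPolynomial (Fin n) k}
    (hx : IsHomog deg₁ e x) (hy : IsHomog deg₂ e y) :
    IsHomog (Sum.elim deg₁ deg₂) e ((sumEquiv k n α β).symm (x, y)) := by
  rintro (b | b) w hw
  · exact hx b w (by simpa [sumEquiv] using hw)
  · exact hy b w (by simpa [sumEquiv] using hw)

theorem isHomog_zero {ι : Type} (deg : ι → ℕ) (e : ℕ) :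
    IsHomog deg e (0 : ι →₀ MvPolynomial (Fin n) k) := by
  intro b w hw
  simp at hw

theorem IsHomog.neg {ι : Type} {deg : ι → ℕ} {e : ℕ} {x : ι →₀ MvPolynomial (Fin n) k}
    (hx : IsHomog deg e x) : IsHomog deg e (-x) := by
  intro b w hw
  exact hx b w (by simpa using hw)

/-- The zero complex. -/
noncomputable def zero (k : Type u) [Field k] (n : ℕ) : FreeComplex k n where
  ι _ := Empty
  fin _ := inferInstance
  deg _ b := b.elim
  d _ := 0
  d_comp_d _ := by simp
  d_homog _ b := b.elim

/-- The complex `S(-e)` concentrated in homological degree `0`. -/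
noncomputable def single (k : Type u) [Field k] (n : ℕ) (e : ℕ) : FreeComplex k n where
  ι
    | 0 => Unit
    | _ + 1 => Empty
  fin
    | 0 => inferInstanceAs (Finite Unit)
    | _ + 1 => inferInstanceAs (Finite Empty)
  deg _ _ := e
  d _ := 0
  d_comp_d _ := by simp
  d_homog _ b := Empty.elim b

/-- The direct sum of two complexes. -/
noncomputable def sum (F G : FreeComplex k n) : FreeComplex k n where
  ι i := F.ι i ⊕ G.ι i
  fin i := by
    have := F.fin i
    have := G.fin i
    infer_instance
  deg i := Sum.elim (F.deg i) (G.deg i)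
  d i := (sumEquiv k n (F.ι i) (G.ι i)).symm.toLinearMap ∘ₗ (F.d i).prodMap (G.d i) ∘ₗ
    (sumEquiv k n (F.ι (i + 1)) (G.ι (i + 1))).toLinearMap
  d_comp_d i := by
    have h₁ := fun x => LinearMap.congr_fun (F.d_comp_d i) x
    have h₂ := fun x => LinearMap.congr_fun (G.d_comp_d i) x
    simp only [LinearMap.comp_apply, LinearMap.zero_apply] at h₁ h₂
    refine LinearMap.ext fun x => ?_
    simp only [LinearMap.comp_apply, LinearEquiv.coe_coe, LinearEquiv.apply_symm_apply,
      LinearMap.prodMap_apply, h₁, h₂, LinearMap.zero_apply]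
    exact map_zero _
  d_homog i b := by
    rcases b with b | b
    · simp only [LinearMap.comp_apply, LinearEquiv.coe_coe, sumEquiv_single_inl,
        LinearMap.prodMap_apply, map_zero]
      exact isHomog_sumEquiv_symm (F.d_homog i b) (isHomog_zero _ _)
    · simp only [LinearMap.comp_apply, LinearEquiv.coe_coe, sumEquiv_single_inr,
        LinearMap.prodMap_apply, map_zero]
      exact isHomog_sumEquiv_symm (isHomog_zero _ _) (G.d_homog i b)

variable {F G : FreeComplex k n}

/-- The basis of the mapping cone of a morphism `F → G`:
`Cone_0 = G_0` and `Cone_{i+1} = F_i ⊕ G_{i+1}`. -/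
def coneι (F G : FreeComplex k n) : ℕ → Type
  | 0 => G.ι 0
  | i + 1 => F.ι i ⊕ G.ι (i + 1)

/-- The degrees of the basis elements of the mapping cone. -/
def coneDeg (F G : FreeComplex k n) : ∀ i, coneι F G i → ℕ
  | 0 => G.deg 0
  | i + 1 => Sum.elim (F.deg i) (G.deg (i + 1))

/-- The differential `(x, y) ↦ φ x + d y` of the mapping cone, from `F_0 ⊕ G_1` to `G_0`. -/
noncomputable def coneDZero (φ : Hom F G) :
    (F.ι 0 ⊕ G.ι 1 →₀ MvPolynomial (Fin n) k) →ₗ[MvPolynomial (Fin n) k]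
      (G.ι 0 →₀ MvPolynomial (Fin n) k) :=
  ((φ.f 0).coprod (G.d 0)) ∘ₗ (sumEquiv k n (F.ι 0) (G.ι 1)).toLinearMap

/-- The differential `(x, y) ↦ (-d x, φ x + d y)` of the mapping cone,
from `F_{i+1} ⊕ G_{i+2}` to `F_i ⊕ G_{i+1}`. -/
noncomputable def coneDSucc (φ : Hom F G) (i : ℕ) :
    (F.ι (i + 1) ⊕ G.ι (i + 2) →₀ MvPolynomial (Fin n) k) →ₗ[MvPolynomial (Fin n) k]
      (F.ι i ⊕ G.ι (i + 1) →₀ MvPolynomial (Fin n) k) :=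
  (sumEquiv k n (F.ι i) (G.ι (i + 1))).symm.toLinearMap ∘ₗ
    ((-(F.d i) ∘ₗ LinearMap.fst _ _ _).prod ((φ.f (i + 1)).coprod (G.d (i + 1)))) ∘ₗ
    (sumEquiv k n (F.ι (i + 1)) (G.ι (i + 2))).toLinearMap

theorem coneDZero_comp (φ : Hom F G) : coneDZero φ ∘ₗ coneDSucc φ 0 = 0 := by
  have h₂ := fun x => LinearMap.congr_fun (G.d_comp_d 0) x
  have h₃ := fun x => LinearMap.congr_fun (φ.comm 0) x
  simp only [LinearMap.comp_apply, LinearMap.zero_apply] at h₂ h₃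
  refine LinearMap.ext fun x => ?_
  simp [coneDZero, coneDSucc, h₂, h₃]

theorem coneDSucc_comp (φ : Hom F G) (i : ℕ) : coneDSucc φ i ∘ₗ coneDSucc φ (i + 1) = 0 := by
  have h₁ := fun j x => LinearMap.congr_fun (F.d_comp_d j) x
  have h₂ := fun j x => LinearMap.congr_fun (G.d_comp_d j) x
  have h₃ := fun j x => LinearMap.congr_fun (φ.comm j) x
  simp only [LinearMap.comp_apply, LinearMap.zero_apply] at h₁ h₂ h₃
  refine LinearMap.ext fun x => ?_
  simp [coneDSucc, h₁, h₂, h₃]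

theorem coneDZero_homog (φ : Hom F G) (b : F.ι 0 ⊕ G.ι 1) :
    IsHomog (G.deg 0) (Sum.elim (F.deg 0) (G.deg 1) b) (coneDZero φ (Finsupp.single b 1)) := by
  rcases b with b | b
  · simp only [coneDZero, LinearMap.comp_apply, LinearEquiv.coe_coe, sumEquiv_single_inl,
      LinearMap.coprod_apply, map_zero, add_zero]
    exact φ.f_homog 0 b
  · simp only [coneDZero, LinearMap.comp_apply, LinearEquiv.coe_coe, sumEquiv_single_inr,
      LinearMap.coprod_apply, map_zero, zero_add]
    exact G.d_homog 0 b

theorem coneDSucc_homog (φ : Hom F G) (i : ℕ) (b : F.ι (i + 1) ⊕ G.ι (i + 2)) :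
    IsHomog (Sum.elim (F.deg i) (G.deg (i + 1))) (Sum.elim (F.deg (i + 1)) (G.deg (i + 2)) b)
      (coneDSucc φ i (Finsupp.single b 1)) := by
  rcases b with b | b
  · simp only [coneDSucc, LinearMap.comp_apply, LinearEquiv.coe_coe, sumEquiv_single_inl,
      LinearMap.prod_apply, Function.prod_apply, LinearMap.neg_apply, LinearMap.fst_apply,
      LinearMap.coprod_apply, map_zero, add_zero]
    exact isHomog_sumEquiv_symm (IsHomog.neg (F.d_homog i b)) (φ.f_homog (i + 1) b)
  · simp only [coneDSucc, LinearMap.comp_apply, LinearEquiv.coe_coe, sumEquiv_single_inr,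
      LinearMap.prod_apply, Function.prod_apply, LinearMap.neg_apply, LinearMap.fst_apply,
      LinearMap.coprod_apply, map_zero, zero_add, neg_zero]
    exact isHomog_sumEquiv_symm (isHomog_zero _ _) (G.d_homog (i + 1) b)

/-- The mapping cone of a morphism of complexes of graded free modules. -/
noncomputable def cone (φ : Hom F G) : FreeComplex k n where
  ι := coneι F G
  fin
    | 0 => G.fin 0
    | i + 1 => by
      have := F.fin i
      have := G.fin (i + 1)
      exact inferInstanceAs (Finite (F.ι i ⊕ G.ι (i + 1)))
  deg := coneDeg F G
  d
    | 0 => coneDZero φ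
    | i + 1 => coneDSucc φ i
  d_comp_d
    | 0 => coneDZero_comp φ
    | i + 1 => coneDSucc_comp φ i
  d_homog
    | 0 => coneDZero_homog φ
    | i + 1 => coneDSucc_homog φ i

end FreeComplex

section Resolutions

variable {k : Type u} [Field k] {n : ℕ} {M : Type v} [AddCommGroup M]
  [Module (MvPolynomial (Fin n) k) M] [Module k M]

/-- A minimal graded free resolution `⋯ → F_1 → F_0 → M → 0` of the graded `S`-module `M`
whose component of degree `e` is `gr e`. -/
structure MinimalResolution (gr : ℕ → Submodule k M) extends FreeComplex k n where
  aug : (ι 0 →₀ MvPolynomial (Fin n) k) →ₗ[MvPolynomial (Fin n) k] M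
  aug_homog : ∀ b, aug (Finsupp.single b 1) ∈ gr (deg 0 b)
  aug_surjective : Function.Surjective aug
  exact_zero : LinearMap.ker aug = LinearMap.range (d 0)
  exact_succ : ∀ i, LinearMap.ker (d i) = LinearMap.range (d (i + 1))
  minimal : toFreeComplex.IsMinimal

/-- `β_i(M) = b`: the graded module `M` has a minimal graded free resolution, and the `i`-th
module of every minimal graded free resolution of `M` has rank `b`. -/
def HasBettiNumber (gr : ℕ → Submodule k M) (i b : ℕ) : Prop :=
  Nonempty (MinimalResolution (n := n) gr) ∧
    ∀ F : MinimalResolution (n := n) gr, F.rank i = b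

/-- `reg(M) = r` for the Castelnuovo–Mumford regularity: the graded module `M` has a minimal
graded free resolution, and in every minimal graded free resolution of `M`, the number `r` is the
maximum of `e - i` over the basis elements of degree `e` of the `i`-th module
(i.e. over all `i`, `e` with `β_{i,e}(M) ≠ 0`). -/
def HasRegularity (gr : ℕ → Submodule k M) (r : ℤ) : Prop :=
  Nonempty (MinimalResolution (n := n) gr) ∧
    ∀ F : MinimalResolution (n := n) gr,
      IsGreatest {x : ℤ | ∃ (i : ℕ) (b : F.ι i), x = (F.deg i b : ℤ) - i} r

end Resolutions

section Ideals

variable {k : Type u} [Field k] {n : ℕ}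

/-- The standard grading of an ideal `I` of `S`: the homogeneous polynomials of degree `e`
which lie in `I`. -/
noncomputable def idealGrading (I : Ideal (MvPolynomial (Fin n) k)) (e : ℕ) : Submodule k I :=
  (homogeneousSubmodule (Fin n) k e).comap (I.subtype.restrictScalars k)

/-- The standard grading of `S / I`: the classes of the homogeneous polynomials of degree `e`. -/
noncomputable def quotientGrading (I : Ideal (MvPolynomial (Fin n) k)) (e : ℕ) :
    Submodule k (MvPolynomial (Fin n) k ⧸ I) :=
  (homogeneousSubmodule (Fin n) k e).map (Ideal.Quotient.mkₐ k I).toLinearMap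

/-- The monomial `y^a`. -/
noncomputable abbrev mono (k : Type u) [Field k] {n : ℕ} (a : Fin n →₀ ℕ) :
    MvPolynomial (Fin n) k := monomial a 1

/-- The ideal generated by the monomials with exponents in the list `L`. -/
noncomputable def monomialSpan (k : Type u) [Field k] {n : ℕ} (L : List (Fin n →₀ ℕ)) :
    Ideal (MvPolynomial (Fin n) k) := Ideal.span {p | ∃ a ∈ L, p = mono k a}

/-- `L` lists, in some order and without repetitions, the exponents of the minimal monomial
generating set `G(I)` of the monomial ideal `I`: the monomials generate `I`, and none of them
divides another one. -/
def IsMinimalGenerators (L : List (Fin n →₀ ℕ)) (I : Ideal (MvPolynomial (Fin n) k)) : Prop :=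
  I = monomialSpan k L ∧ L.Pairwise (fun a b => ¬ a ≤ b ∧ ¬ b ≤ a)

/-- The augmentation `F_0 ⊕ S(-|g|) → S`, `(x, c) ↦ ε x + c y^g`. It is the composite of
`ε ⊕ y^g : F_0 ⊕ S(-|g|) → I ⊕ ⟨y^g⟩` with the addition map onto `I + ⟨y^g⟩ ⊆ S`. -/
noncomputable def coneAug (F : FreeComplex k n)
    (ε : F.obj 0 →ₗ[MvPolynomial (Fin n) k] MvPolynomial (Fin n) k) (g : Fin n →₀ ℕ) :
    (F.sum (FreeComplex.single k n g.degree)).obj 0 →ₗ[MvPolynomial (Fin n) k]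
      MvPolynomial (Fin n) k :=
  (ε.coprod (Finsupp.linearCombination (MvPolynomial (Fin n) k) (fun _ : Unit => mono k g))) ∘ₗ
    (FreeComplex.sumEquiv k n (F.ι 0) Unit).toLinearMap

/-- `φ : F̃ → F ⊕ S(-|g|)` lifts the inclusion `I ∩ ⟨y^g⟩ → I ⊕ ⟨y^g⟩`, `z ↦ (z, -z)`, where
`F̃` and `F` resolve `I ∩ ⟨y^g⟩` and `I` through the augmentations `ε'` and `ε`. -/
def LiftsInclusion {F' F : FreeComplex k n}
    (ε' : F'.obj 0 →ₗ[MvPolynomial (Fin n) k] MvPolynomial (Fin n) k)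
    (ε : F.obj 0 →ₗ[MvPolynomial (Fin n) k] MvPolynomial (Fin n) k) (g : Fin n →₀ ℕ)
    (φ : F'.Hom (F.sum (FreeComplex.single k n g.degree))) : Prop :=
  ∀ x : F'.obj 0,
    ε (FreeComplex.sumEquiv k n (F.ι 0) Unit (φ.f 0 x)).1 = ε' x ∧
    (FreeComplex.sumEquiv k n (F.ι 0) Unit (φ.f 0 x)).2 () * mono k g = -ε' x

/-- `IsIteratedMappingCone L F ε`: the complex `F`, with the augmentation `ε : F_0 → S`, is an
iterated mapping cone resolution of the monomial ideal `I` whose minimal monomial generators are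
listed (the last one first) by `L`. For the zero ideal it is the zero complex. If the generators
are `g_1, …, g_r`, then with `I' = ⟨g_1, …, g_{r-1}⟩` and `Ĩ = I' ∩ ⟨g_r⟩` the short exact sequence
`0 → Ĩ → I' ⊕ ⟨g_r⟩ → I → 0` gives the mapping cone of any lift
`F̃ → F' ⊕ S(-deg g_r)` of the inclusion, where `F̃` and `F'` are iterated mapping
cone resolutions of `Ĩ` (for any order of its minimal generators) and of `I'`. -/
inductive IsIteratedMappingCone : List (Fin n →₀ ℕ) → (F : FreeComplex k n) →
    (F.obj 0 →ₗ[MvPolynomial (Fin n) k] MvPolynomial (Fin n) k) → Prop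
  | nil : IsIteratedMappingCone [] (FreeComplex.zero k n) 0
  | cons (g : Fin n →₀ ℕ) (L L' : List (Fin n →₀ ℕ)) (F F' : FreeComplex k n)
      (ε : F.obj 0 →ₗ[MvPolynomial (Fin n) k] MvPolynomial (Fin n) k)
      (ε' : F'.obj 0 →ₗ[MvPolynomial (Fin n) k] MvPolynomial (Fin n) k)
      (φ : F'.Hom (F.sum (FreeComplex.single k n g.degree)))
      (hF : IsIteratedMappingCone L F ε)
      (hF' : IsIteratedMappingCone L' F' ε')
      (hgens : IsMinimalGenerators (k := k) (g :: L) (monomialSpan k (g :: L)))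
      (hL' : IsMinimalGenerators L' (monomialSpan k L ⊓ Ideal.span {mono k g}))
      (hφ : LiftsInclusion ε' ε g φ) :
      IsIteratedMappingCone (g :: L) (FreeComplex.cone φ) (coneAug F ε g)

/-- The ideal `J_{n,m} = ⟨y_1^m, …, y_n^m, y_1^{m-a} y_j^a (2 ≤ j ≤ n, 1 ≤ a ≤ m - 1)⟩`;
the variable `y_j` is `X (j - 1)`. -/
noncomputable def linesIdeal (k : Type u) [Field k] (n m : ℕ) [NeZero n] :
    Ideal (MvPolynomial (Fin n) k) :=
  Ideal.span ({p | ∃ j : Fin n, p = X j ^ m} ∪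
    {p | ∃ (j : Fin n) (a : ℕ), j ≠ 0 ∧ 1 ≤ a ∧ a < m ∧ p = X 0 ^ (m - a) * X j ^ a})

end Ideals

end GradedRes

/-! Number the variables from 0. The ideal is built from `y_0^m` by adding, for `b = 1, …, m` and
within each `b` for `j = 1, …, n-1`, the generator `g = y_0^{m-b} y_j^b`. The intersection of `⟨g⟩`
with the ideal of the preceding generators is `g⟨y_0, y_1^b, …, y_{j-1}^b⟩` (`lineRow_inf_lineGen`).
This is a shifted complete intersection, whose Koszul-type resolution is itself an iterated mapping
cone (`exists_isConeResolution_powersList`).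

Every cone is minimal for degree reasons. In homological degree `i` the resolution of the preceding
ideal lives in degrees at most `m + ib`, and that of the intersection in degrees at least `m + 1 +
ib`. A degree-preserving lift therefore has no nonzero constant entries, whichever lift is chosen
(`IsConeResolution.exists_cons`).

Numerics follow from the construction. The generator with index `j` contributes `C(j, i+1)` basis
elements in homological degree `i + 1`. Summing over `j` and `b` gives rank `m C(n, i+2)` there,
which `mul_choose_eq` rewrites in the stated form. The last row, `b = m`, yields a basis element of
degree `m + 1 + (n-2)m` in homological degree `n - 1`, and this realises the regularity.

The assertions quantify over all minimal resolutions, so uniqueness is proved as well. Comparison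
maps between two minimal resolutions are mutually inverse modulo `𝔪`, because a chain map over zero
is null-homotopic; hence ranks and degrees agree. For the projective dimension, the length of the
resolution bounds it above, and minimality at the last step prevents the syzygy sequence from
splitting. -/

namespace GradedRes

/-! ### Graded lifting: comparison theorem and null-homotopies. -/

section Lifting

variable {k : Type u} [Field k] {n : ℕ}

/-- The submodule `𝔪 M` of a module `M`, where `𝔪 = ⟨y_1, …, y_n⟩`. -/
noncomputable abbrev maxSMul (k : Type u) [Field k] (n : ℕ) (M : Type*) [AddCommGroup M]
    [Module (MvPolynomial (Fin n) k) M] : Submodule (MvPolynomial (Fin n) k) M :=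
  (Ideal.span (Set.range (X : Fin n → MvPolynomial (Fin n) k))) •
    (⊤ : Submodule (MvPolynomial (Fin n) k) M)

theorem mem_span_range_X_iff (p : MvPolynomial (Fin n) k) :
    p ∈ Ideal.span (Set.range (X : Fin n → MvPolynomial (Fin n) k)) ↔ constantCoeff p = 0 := by
  have h := mem_pow_idealOfVars_iff' (σ := Fin n) (R := k) 1 p
  rw [pow_one] at h
  refine h.trans ⟨fun h => h 0 (by simp), fun h x hx => ?_⟩
  have : x = 0 := by
    rw [← Finsupp.degree_eq_zero_iff]
    omega
  rw [this]
  exact h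

theorem mem_maxSMul_iff {ι : Type} (x : ι →₀ MvPolynomial (Fin n) k) :
    x ∈ maxSMul k n (ι →₀ MvPolynomial (Fin n) k) ↔ ∀ b, constantCoeff (x b) = 0 := by
  constructor
  · intro hx b
    refine Submodule.smul_induction_on hx (fun r hr y _ => ?_) (fun y z hy hz => ?_)
    · rw [mem_span_range_X_iff] at hr
      simp [hr]
    · simp [hy, hz]
  · intro hx
    rw [← Finsupp.sum_single x]
    refine Submodule.sum_mem _ fun b _ => ?_
    have : Finsupp.single b (x b) = x b • Finsupp.single b (1 : MvPolynomial (Fin n) k) := by simp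
    rw [this]
    exact Submodule.smul_mem_smul ((mem_span_range_X_iff _).2 (hx b)) trivial

theorem map_mem_maxSMul {M N : Type*} [AddCommGroup M] [Module (MvPolynomial (Fin n) k) M]
    [AddCommGroup N] [Module (MvPolynomial (Fin n) k) N] (f : M →ₗ[MvPolynomial (Fin n) k] N)
    {x : M} (hx : x ∈ maxSMul k n M) : f x ∈ maxSMul k n N := by
  have h : f x ∈ (maxSMul k n M).map f := ⟨x, hx, rfl⟩
  rw [Submodule.map_smul''] at h
  exact Submodule.smul_mono le_rfl le_top h

/-- A linear map from a free module lifts along any linear map whose range contains its range. -/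
theorem exists_comp_eq {R : Type*} [CommRing R] {ι : Type*} {M N : Type*} [AddCommGroup M]
    [Module R M] [AddCommGroup N] [Module R N] (f : (ι →₀ R) →ₗ[R] N) (g : M →ₗ[R] N)
    (h : ∀ b, f (Finsupp.single b 1) ∈ LinearMap.range g) :
    ∃ l : (ι →₀ R) →ₗ[R] M, g ∘ₗ l = f := by
  choose s hs using h
  refine ⟨Finsupp.linearCombination R s, ?_⟩
  ext b
  simp [hs]

/-- The graded pieces `gr e` of `M` are cut out by additive projections, and are compatible with
the grading of the polynomial ring. -/
structure IsGrading {M : Type v} [AddCommGroup M] [Module (MvPolynomial (Fin n) k) M] [Module k M]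
    (gr : ℕ → Submodule k M) : Prop where
  smul_mem : ∀ {d e : ℕ} {p : MvPolynomial (Fin n) k} {x : M}, p.IsHomogeneous d → x ∈ gr e →
    p • x ∈ gr (d + e)
  exists_proj : ∀ e, ∃ π : M →+ M, (∀ x ∈ gr e, π x = x) ∧ ∀ e' ≠ e, ∀ x ∈ gr e', π x = 0

theorem isHomog_single {ι : Type} {deg : ι → ℕ} {b : ι} {w : Fin n →₀ ℕ} {e : ℕ}
    (h : w.degree + deg b = e) (c : k) :
    IsHomog deg e (Finsupp.single b (monomial w c)) := by
  classical
  intro b' w' hw'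
  rw [Finsupp.single_apply] at hw'
  split_ifs at hw' with hb
  · subst hb
    have := support_monomial_subset hw'
    simp only [Finset.mem_singleton] at this
    rw [this, h]
  · simp at hw'

theorem IsHomog.add {ι : Type} {deg : ι → ℕ} {e : ℕ} {x y : ι →₀ MvPolynomial (Fin n) k}
    (hx : IsHomog deg e x) (hy : IsHomog deg e y) : IsHomog deg e (x + y) := by
  classical
  intro b w hw
  rcases Finset.mem_union.1 (support_add hw) with h | h
  · exact hx b w h
  · exact hy b w h

/-- The degree `e` part of any preimage is again a preimage, since `ε` preserves degrees. This is
what makes lifts of homogeneous elements homogeneous. -/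
theorem IsGrading.exists_homog_preimage {M : Type v} [AddCommGroup M]
    [Module (MvPolynomial (Fin n) k) M] [Module k M] {gr : ℕ → Submodule k M}
    (hgr : IsGrading (n := n) gr) {ι : Type} {deg : ι → ℕ}
    (ε : (ι →₀ MvPolynomial (Fin n) k) →ₗ[MvPolynomial (Fin n) k] M)
    (hε : ∀ b, ε (Finsupp.single b 1) ∈ gr (deg b)) {e : ℕ}
    (x : ι →₀ MvPolynomial (Fin n) k) (hx : ε x ∈ gr e) :
    ∃ x', IsHomog deg e x' ∧ ε x' = ε x := by
  obtain ⟨π, hπ, hπ'⟩ := hgr.exists_proj e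
  -- The condition `ε x ∈ gr e` does not pass to summands of `x`. Projecting by `π` gives an
  -- additive statement, which can be checked on single monomials.
  suffices h : ∃ x', IsHomog deg e x' ∧ ε x' = π (ε x) by rwa [hπ _ hx] at h
  clear hx
  induction x using Finsupp.induction_linear with
  | zero => exact ⟨0, FreeComplex.isHomog_zero _ _, by simp⟩
  | add x y hx hy =>
    obtain ⟨x', hx', hx⟩ := hx
    obtain ⟨y', hy', hy⟩ := hy
    exact ⟨x' + y', hx'.add hy', by simp [hx, hy]⟩
  | single b p =>
    induction p using MvPolynomial.induction_on' with
    | monomial w a =>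
      have key : ε (Finsupp.single b (monomial w a)) ∈ gr (w.degree + deg b) := by
        have := hgr.smul_mem (isHomogeneous_monomial a (d := w) rfl) (hε b)
        rwa [← map_smul, Finsupp.smul_single, smul_eq_mul, mul_one] at this
      by_cases h : w.degree + deg b = e
      · rw [h] at key
        exact ⟨_, isHomog_single h a, (hπ _ key).symm⟩
      · exact ⟨0, FreeComplex.isHomog_zero _ _, by rw [hπ' _ h _ key, map_zero]⟩
    | add p q hp hq =>
      obtain ⟨x', hx', hx⟩ := hp
      obtain ⟨y', hy', hy⟩ := hq
      exact ⟨x' + y', hx'.add hy', by rw [Finsupp.single_add, map_add, map_add, map_add, hx, hy]⟩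

theorem isHomogeneous_of_degree_eq {p : MvPolynomial (Fin n) k} {d : ℕ}
    (h : ∀ w ∈ p.support, w.degree = d) : p.IsHomogeneous d := by
  intro w hw
  rw [← h w (mem_support_iff.2 hw), Finsupp.degree_eq_weight_one]
  rfl

theorem IsHomog.isHomogeneous {ι : Type} {deg : ι → ℕ} {e : ℕ}
    {x : ι →₀ MvPolynomial (Fin n) k} (hx : IsHomog deg e x) (b : ι) :
    (x b).IsHomogeneous (e - deg b) :=
  isHomogeneous_of_degree_eq fun w hw => by
    have := hx b w hw
    omega

theorem IsHomog.le_of_mem_support {ι : Type} {deg : ι → ℕ} {e : ℕ}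
    {x : ι →₀ MvPolynomial (Fin n) k} (hx : IsHomog deg e x) {b : ι} (hb : b ∈ x.support) :
    deg b ≤ e := by
  obtain ⟨w, hw⟩ := support_nonempty.2 (Finsupp.mem_support_iff.1 hb)
  have hw' := hx b w hw
  omega

/-- The homogeneous elements of degree `e` of a graded free module. -/
def homogSubmodule (k : Type u) [Field k] (n : ℕ) {ι : Type} (deg : ι → ℕ) (e : ℕ) :
    Submodule k (ι →₀ MvPolynomial (Fin n) k) where
  carrier := {x | IsHomog deg e x}
  add_mem' := IsHomog.add
  zero_mem' := FreeComplex.isHomog_zero _ _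
  smul_mem' _ _ hx b w hw := hx b w (support_smul hw)

theorem isGrading_homogSubmodule {ι : Type} (deg : ι → ℕ) :
    IsGrading (n := n) (homogSubmodule k n deg) where
  smul_mem {d e p x} hp hx b w hw := by
    classical
    obtain ⟨w₁, h₁, w₂, h₂, rfl⟩ := Finset.mem_add.1 (support_mul _ _ hw)
    rw [map_add, add_assoc, hx b w₂ h₂, hp.degree_eq_sum_deg_support h₁]
    rfl
  exists_proj e := by
    classical
    -- The test `deg b ≤ e` is needed because the subtraction `e - deg b` truncates to `0` and would
    -- otherwise retain constants of the wrong degree.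
    refine ⟨Finsupp.liftAddHom fun b => (Finsupp.singleAddHom b).comp
      (if deg b ≤ e then (homogeneousComponent (e - deg b)).toAddMonoidHom else 0), ?_, ?_⟩
    · intro x hx
      conv_rhs => rw [← Finsupp.sum_single x]
      rw [Finsupp.liftAddHom_apply]
      refine Finsupp.sum_congr fun b hb => ?_
      rw [if_pos (hx.le_of_mem_support hb)]
      exact congrArg (Finsupp.single b) (homogeneousComponent_eq_self (hx.isHomogeneous b))
    · intro e' he' x hx
      rw [Finsupp.liftAddHom_apply]
      refine Finset.sum_eq_zero fun b hb => ?_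
      show Finsupp.single b ((if deg b ≤ e then
        (homogeneousComponent (e - deg b)).toAddMonoidHom else 0) (x b)) = 0
      rw [Finsupp.single_eq_zero]
      split_ifs with h
      · refine homogeneousComponent_eq_zero' _ _ fun w hw => ?_
        have := hx b w hw
        omega
      · rfl

theorem FreeComplex.exists_homog_d_eq (F : FreeComplex k n) {i e : ℕ} (x : F.obj (i + 1))
    (hx : IsHomog (F.deg i) e (F.d i x)) :
    ∃ x', IsHomog (F.deg (i + 1)) e x' ∧ F.d i x' = F.d i x :=
  (isGrading_homogSubmodule (F.deg i)).exists_homog_preimage (F.d i) (F.d_homog i) x hx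

/-- A degree-preserving linear map sends homogeneous elements to homogeneous elements. -/
theorem IsHomog.map {ι κ : Type} {deg : ι → ℕ} {deg' : κ → ℕ}
    {f : (ι →₀ MvPolynomial (Fin n) k) →ₗ[MvPolynomial (Fin n) k] (κ →₀ MvPolynomial (Fin n) k)}
    (hf : ∀ b, IsHomog deg' (deg b) (f (Finsupp.single b 1))) {e : ℕ}
    {x : ι →₀ MvPolynomial (Fin n) k} (hx : IsHomog deg e x) : IsHomog deg' e (f x) := by
  classical
  have : f x ∈ homogSubmodule k n deg' e := by
    rw [← Finsupp.sum_single x, Finsupp.sum, map_sum]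
    refine Submodule.sum_mem _ fun b hb => ?_
    have h := hx.le_of_mem_support hb
    have := (isGrading_homogSubmodule deg').smul_mem (hx.isHomogeneous b) (hf b)
    rwa [← map_smul, Finsupp.smul_single, smul_eq_mul, mul_one, Nat.sub_add_cancel h] at this
  exact this

namespace FreeComplex

variable {N : Type v} [AddCommGroup N] [Module (MvPolynomial (Fin n) k) N]

/-- The comparison theorem: a map out of the augmentation of a complex of free modules lifts
along an exact complex. -/
theorem exists_hom_lift (P Q : FreeComplex k n)
    (α : P.obj 0 →ₗ[MvPolynomial (Fin n) k] N) (η : Q.obj 0 →ₗ[MvPolynomial (Fin n) k] N)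
    (hα : α ∘ₗ P.d 0 = 0) (hη : LinearMap.ker η = LinearMap.range (Q.d 0))
    (hQ : ∀ i, LinearMap.ker (Q.d i) = LinearMap.range (Q.d (i + 1)))
    (h0 : ∀ b, ∃ x, IsHomog (Q.deg 0) (P.deg 0 b) x ∧ η x = α (Finsupp.single b 1)) :
    ∃ φ : P.Hom Q, η ∘ₗ φ.f 0 = α := by
  -- Each component is bundled with the condition that `f ∘ d` lands in the range of `d`: exactly
  -- what is needed to lift once more, so that the recursion can run one component at a time.
  let T : ℕ → Type u := fun i =>
    {f : P.obj i →ₗ[MvPolynomial (Fin n) k] Q.obj i //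
      (∀ b, IsHomog (Q.deg i) (P.deg i b) (f (Finsupp.single b 1))) ∧
        ∀ x, f (P.d i x) ∈ LinearMap.range (Q.d i)}
  have start : ∃ f : T 0, η ∘ₗ f.1 = α := by
    choose s hs hs' using h0
    have h : η ∘ₗ Finsupp.linearCombination _ s = α := by
      ext b
      simp [hs']
    refine ⟨⟨Finsupp.linearCombination _ s, fun b => by simpa using hs b, fun x => ?_⟩, h⟩
    rw [← hη, LinearMap.mem_ker, ← LinearMap.comp_apply, h, ← LinearMap.comp_apply, hα]
    rfl
  have step : ∀ i (f : T i), ∃ f' : T (i + 1), Q.d i ∘ₗ f'.1 = f.1 ∘ₗ P.d i := by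
    rintro i ⟨f, hf, hf'⟩
    have : ∀ b, ∃ x, IsHomog (Q.deg (i + 1)) (P.deg (i + 1) b) x ∧
        Q.d i x = f (P.d i (Finsupp.single b 1)) := by
      intro b
      obtain ⟨y, hy⟩ := hf' (Finsupp.single b 1)
      have := Q.exists_homog_d_eq y (by rw [hy]; exact (P.d_homog i b).map hf)
      rwa [hy] at this
    choose s hs hs' using this
    have h : Q.d i ∘ₗ Finsupp.linearCombination _ s = f ∘ₗ P.d i := by
      ext1 b
      ext1
      simp [hs']
    refine ⟨⟨Finsupp.linearCombination _ s, fun b => by simpa using hs b, fun x => ?_⟩, h⟩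
    have h' := LinearMap.congr_fun (P.d_comp_d i) x
    simp only [LinearMap.comp_apply, LinearMap.zero_apply] at h'
    rw [← hQ, LinearMap.mem_ker, ← LinearMap.comp_apply, h, LinearMap.comp_apply, h', map_zero]
  obtain ⟨f₀, hf₀⟩ := start
  choose next hnext using step
  let f : ∀ i, T i := fun i => Nat.rec f₀ next i
  exact ⟨⟨fun i => (f i).1, fun i => hnext i (f i), fun i => (f i).2.1⟩, hf₀⟩

/-- A chain map which vanishes after augmentation is null-homotopic, so on a minimal exact
complex it has image in `𝔪 F`. -/
theorem mem_maxSMul_of_aug_comp_eq_zero (F : FreeComplex k n)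
    (η : F.obj 0 →ₗ[MvPolynomial (Fin n) k] N)
    (hη : LinearMap.ker η = LinearMap.range (F.d 0))
    (hF : ∀ i, LinearMap.ker (F.d i) = LinearMap.range (F.d (i + 1))) (hmin : F.IsMinimal)
    (χ : ∀ i, F.obj i →ₗ[MvPolynomial (Fin n) k] F.obj i)
    (hχ : ∀ i, F.d i ∘ₗ χ (i + 1) = χ i ∘ₗ F.d i) (h0 : η ∘ₗ χ 0 = 0) (i : ℕ) (x : F.obj i) :
    χ i x ∈ maxSMul k n (F.obj i) := by
  have hdd := fun i x => LinearMap.congr_fun (F.d_comp_d i) x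
  have hχ' := fun i x => LinearMap.congr_fun (hχ i) x
  simp only [LinearMap.comp_apply, LinearMap.zero_apply] at hdd hχ'
  -- The induction carries a homotopy `h` for which `χ - h d` consists of cycles in the next degree.
  -- Lifting these cycles along `d` gives `χ = d h' + h d`, and both terms lie in `𝔪 F` by
  -- minimality.
  suffices h : (∃ h : F.obj i →ₗ[MvPolynomial (Fin n) k] F.obj (i + 1),
      ∀ x, F.d i (χ (i + 1) x - h (F.d i x)) = 0) ∧ ∀ x, χ i x ∈ maxSMul k n (F.obj i) from
    h.2 x
  clear x
  induction i with
  | zero =>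
    obtain ⟨h, hh⟩ := exists_comp_eq (χ 0) (F.d 0) fun b => by
      rw [← hη, LinearMap.mem_ker, ← LinearMap.comp_apply, h0, LinearMap.zero_apply]
    have hh' := fun x => LinearMap.congr_fun hh x
    simp only [LinearMap.comp_apply] at hh'
    refine ⟨⟨h, fun x => ?_⟩, fun x => ?_⟩
    · rw [map_sub, hχ', hh', sub_self]
    · rw [← hh']
      exact hmin 0 ⟨_, rfl⟩
  | succ i ih =>
    obtain ⟨⟨h, hh⟩, -⟩ := ih
    obtain ⟨h', hh'⟩ := exists_comp_eq (χ (i + 1) - h ∘ₗ F.d i) (F.d (i + 1)) fun b => by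
      rw [← hF, LinearMap.mem_ker]
      exact hh _
    have hh'' := fun x => LinearMap.congr_fun hh' x
    simp only [LinearMap.comp_apply, LinearMap.sub_apply] at hh''
    refine ⟨⟨h', fun x => ?_⟩, fun x => ?_⟩
    · rw [map_sub, hχ', hh'', hdd, map_zero, sub_zero, sub_self]
    · rw [← sub_add_cancel (χ (i + 1) x) (h (F.d i x)), ← hh'']
      exact add_mem (hmin (i + 1) ⟨_, rfl⟩) (map_mem_maxSMul h (hmin i ⟨_, rfl⟩))

end FreeComplex

end Lifting
-- Uniqueness of ranks and degrees in minimal resolutions.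
section Uniqueness

variable {k : Type u} [Field k] {n : ℕ}

/-- Reduction modulo `𝔪` of an element of a free module. -/
noncomputable def residue (k : Type u) [Field k] (n : ℕ) (ι : Type) :
    (ι →₀ MvPolynomial (Fin n) k) →ₗ[k] (ι →₀ k) :=
  Finsupp.mapRange.linearMap (lcoeff k 0)

/-- The constant section of the reduction modulo `𝔪`. -/
noncomputable def residueSection (k : Type u) [Field k] (n : ℕ) (ι : Type) :
    (ι →₀ k) →ₗ[k] (ι →₀ MvPolynomial (Fin n) k) :=
  Finsupp.mapRange.linearMap (Algebra.linearMap k (MvPolynomial (Fin n) k))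

theorem residue_residueSection {ι : Type} (x : ι →₀ k) :
    residue k n ι (residueSection k n ι x) = x := by
  ext b
  simp [residue, residueSection, algebraMap_eq]

theorem residue_eq_iff {ι : Type} (x y : ι →₀ MvPolynomial (Fin n) k) :
    residue k n ι x = residue k n ι y ↔ x - y ∈ maxSMul k n (ι →₀ MvPolynomial (Fin n) k) := by
  rw [mem_maxSMul_iff, Finsupp.ext_iff]
  refine forall_congr' fun b => ?_
  simp [residue, constantCoeff_eq, sub_eq_zero]

/-- The reduction modulo `𝔪` of a map of free modules. -/
noncomputable def residueMap {ι κ : Type}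
    (f : (ι →₀ MvPolynomial (Fin n) k) →ₗ[MvPolynomial (Fin n) k]
      (κ →₀ MvPolynomial (Fin n) k)) : (ι →₀ k) →ₗ[k] (κ →₀ k) :=
  residue k n κ ∘ₗ f.restrictScalars k ∘ₗ residueSection k n ι

/-- The constant section is only `k`-linear, but changing a lift by an element of `𝔪` changes the
image by an element of `𝔪`, so the choice of section is harmless. -/
theorem residueMap_residue {ι κ : Type}
    (f : (ι →₀ MvPolynomial (Fin n) k) →ₗ[MvPolynomial (Fin n) k]
      (κ →₀ MvPolynomial (Fin n) k)) (x : ι →₀ MvPolynomial (Fin n) k) :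
    residueMap f (residue k n ι x) = residue k n κ (f x) := by
  refine (residue_eq_iff _ _).2 ?_
  show f (residueSection k n ι (residue k n ι x)) - f x ∈ _
  rw [← map_sub]
  exact map_mem_maxSMul f ((residue_eq_iff _ _).1 (residue_residueSection _))

theorem residueMap_residueMap {ι κ : Type}
    {f : (ι →₀ MvPolynomial (Fin n) k) →ₗ[MvPolynomial (Fin n) k]
      (κ →₀ MvPolynomial (Fin n) k)}
    {g : (κ →₀ MvPolynomial (Fin n) k) →ₗ[MvPolynomial (Fin n) k]
      (ι →₀ MvPolynomial (Fin n) k)}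
    (h : ∀ x, g (f x) - x ∈ maxSMul k n (ι →₀ MvPolynomial (Fin n) k)) (x : ι →₀ k) :
    residueMap g (residueMap f x) = x := by
  rw [← residue_residueSection (n := n) x, residueMap_residue, residueMap_residue]
  exact (residue_eq_iff _ _).2 (h _)

/-- Free modules that are isomorphic modulo `𝔪` have the same rank. -/
theorem card_eq_of_sub_mem_maxSMul {ι κ : Type}
    (f : (ι →₀ MvPolynomial (Fin n) k) →ₗ[MvPolynomial (Fin n) k]
      (κ →₀ MvPolynomial (Fin n) k))
    (g : (κ →₀ MvPolynomial (Fin n) k) →ₗ[MvPolynomial (Fin n) k]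
      (ι →₀ MvPolynomial (Fin n) k))
    (hgf : ∀ x, g (f x) - x ∈ maxSMul k n (ι →₀ MvPolynomial (Fin n) k))
    (hfg : ∀ x, f (g x) - x ∈ maxSMul k n (κ →₀ MvPolynomial (Fin n) k)) :
    Nat.card ι = Nat.card κ := by
  let e : (ι →₀ k) ≃ₗ[k] (κ →₀ k) := LinearEquiv.ofLinearMap (residueMap f) (residueMap g)
    (LinearMap.ext (residueMap_residueMap hfg)) (LinearMap.ext (residueMap_residueMap hgf))
  exact Nat.card_congr
    ((Finsupp.basisSingleOne (R := k)).indexEquiv (Finsupp.basisSingleOne.map e.symm))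

namespace MinimalResolution

variable {M : Type v} [AddCommGroup M] [Module (MvPolynomial (Fin n) k) M] [Module k M]
  {gr : ℕ → Submodule k M}

theorem aug_comp_d (F : MinimalResolution (n := n) gr) : F.aug ∘ₗ F.d 0 = 0 := by
  ext1 b
  ext1
  have : F.d 0 (Finsupp.single b 1) ∈ LinearMap.ker F.aug := by
    rw [F.exact_zero]
    exact ⟨_, rfl⟩
  simpa using this

theorem exists_hom (hgr : IsGrading (n := n) gr) (F G : MinimalResolution (n := n) gr) :
    ∃ φ : F.toFreeComplex.Hom G.toFreeComplex, G.aug ∘ₗ φ.f 0 = F.aug := by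
  refine FreeComplex.exists_hom_lift _ _ F.aug G.aug F.aug_comp_d G.exact_zero G.exact_succ
    fun b => ?_
  obtain ⟨x, hx⟩ := G.aug_surjective (F.aug (Finsupp.single b 1))
  rw [← hx]
  exact hgr.exists_homog_preimage G.aug G.aug_homog x (by rw [hx]; exact F.aug_homog b)

/-- The chain map `ψφ - id` vanishes after augmentation, hence is null-homotopic. -/
theorem comp_sub_mem_maxSMul {F G : MinimalResolution (n := n) gr}
    (φ : F.toFreeComplex.Hom G.toFreeComplex) (ψ : G.toFreeComplex.Hom F.toFreeComplex)
    (hφ : G.aug ∘ₗ φ.f 0 = F.aug) (hψ : F.aug ∘ₗ ψ.f 0 = G.aug) (i : ℕ) (x : F.obj i) :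
    ψ.f i (φ.f i x) - x ∈ maxSMul k n (F.obj i) := by
  refine F.mem_maxSMul_of_aug_comp_eq_zero F.aug F.exact_zero F.exact_succ F.minimal
    (fun i => ψ.f i ∘ₗ φ.f i - LinearMap.id) (fun i => ?_) ?_ i x
  · rw [LinearMap.comp_sub, ← LinearMap.comp_assoc, ψ.comm, LinearMap.comp_assoc, φ.comm,
      LinearMap.sub_comp]
    rfl
  · rw [LinearMap.comp_sub, ← LinearMap.comp_assoc, hψ, hφ, LinearMap.comp_id, sub_self]

/-- The ranks in minimal graded free resolutions are unique. -/
theorem rank_eq (hgr : IsGrading (n := n) gr) (F G : MinimalResolution (n := n) gr) (i : ℕ) :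
    F.rank i = G.rank i := by
  obtain ⟨φ, hφ⟩ := exists_hom hgr F G
  obtain ⟨ψ, hψ⟩ := exists_hom hgr G F
  exact card_eq_of_sub_mem_maxSMul (φ.f i) (ψ.f i) (comp_sub_mem_maxSMul φ ψ hφ hψ i)
    (comp_sub_mem_maxSMul ψ φ hψ hφ i)

/-- The degrees of the basis elements in minimal graded free resolutions are unique. -/
theorem exists_deg_eq (hgr : IsGrading (n := n) gr) (F G : MinimalResolution (n := n) gr) (i : ℕ)
    (b : F.ι i) : ∃ c : G.ι i, G.deg i c = F.deg i b := by
  obtain ⟨φ, hφ⟩ := exists_hom hgr F G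
  obtain ⟨ψ, hψ⟩ := exists_hom hgr G F
  by_contra! h
  -- A nonzero constant coefficient would force equality of degrees. If all coefficients lie in `𝔪`,
  -- so does `b` itself, as `ψφ b - b` does; this is absurd.
  have h₁ : φ.f i (Finsupp.single b 1) ∈ maxSMul k n (G.obj i) := by
    rw [mem_maxSMul_iff]
    intro c
    by_contra hc
    have := φ.f_homog i b c 0 (mem_support_iff.2 hc)
    exact h c (by simpa using this)
  have h₂ := sub_mem (map_mem_maxSMul (ψ.f i) h₁) (comp_sub_mem_maxSMul φ ψ hφ hψ i
    (Finsupp.single b 1))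
  rw [sub_sub_cancel, mem_maxSMul_iff] at h₂
  simpa using h₂ b

theorem hasBettiNumber (hgr : IsGrading (n := n) gr) (F : MinimalResolution (n := n) gr)
    {i b : ℕ} (h : F.rank i = b) : HasBettiNumber (n := n) gr i b :=
  ⟨⟨F⟩, fun G => (rank_eq hgr G F i).trans h⟩

theorem hasRegularity (hgr : IsGrading (n := n) gr) (F : MinimalResolution (n := n) gr) {r : ℤ}
    (h : IsGreatest {x : ℤ | ∃ (i : ℕ) (b : F.ι i), x = (F.deg i b : ℤ) - i} r) :
    HasRegularity (n := n) gr r := by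
  refine ⟨⟨F⟩, fun G => ?_⟩
  convert h using 1
  ext x
  constructor
  · rintro ⟨i, b, rfl⟩
    obtain ⟨c, hc⟩ := exists_deg_eq hgr G F i b
    exact ⟨i, c, by rw [hc]⟩
  · rintro ⟨i, b, rfl⟩
    obtain ⟨c, hc⟩ := exists_deg_eq hgr F G i b
    exact ⟨i, c, by rw [hc]⟩

end MinimalResolution

end Uniqueness
-- Exactness and minimality of mapping cones.
section Cone

variable {k : Type u} [Field k] {n : ℕ}

namespace FreeComplex

variable {F G : FreeComplex k n}

theorem Hom.d_f (φ : Hom F G) (i : ℕ) (x : F.obj (i + 1)) :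
    G.d i (φ.f (i + 1) x) = φ.f i (F.d i x) :=
  LinearMap.congr_fun (φ.comm i) x

theorem coneDZero_symm (φ : Hom F G) (x : F.obj 0) (y : G.obj 1) :
    coneDZero φ ((sumEquiv k n _ _).symm (x, y)) = φ.f 0 x + G.d 0 y := by
  simp [coneDZero]

theorem coneDSucc_symm (φ : Hom F G) (i : ℕ) (x : F.obj (i + 1)) (y : G.obj (i + 2)) :
    coneDSucc φ i ((sumEquiv k n _ _).symm (x, y)) =
      (sumEquiv k n _ _).symm (-F.d i x, φ.f (i + 1) x + G.d (i + 1) y) := by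
  simp [coneDSucc]

/-- The element `(x, y)` of `F_i ⊕ G_i`. -/
noncomputable def sumMk (F G : FreeComplex k n) (i : ℕ) (x : F.obj i) (y : G.obj i) :
    (F.sum G).obj i :=
  (sumEquiv k n _ _).symm (x, y)

theorem exists_sumMk (F G : FreeComplex k n) (i : ℕ) (z : (F.sum G).obj i) :
    ∃ x y, z = sumMk F G i x y :=
  ⟨_, _, ((sumEquiv k n (F.ι i) (G.ι i)).symm_apply_apply z).symm⟩

theorem sumMk_injective {F G : FreeComplex k n} {i : ℕ} {x x' : F.obj i} {y y' : G.obj i}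
    (h : sumMk F G i x y = sumMk F G i x' y') : x = x' ∧ y = y' :=
  Prod.mk.inj ((sumEquiv k n _ _).symm.injective h)

theorem sumMk_zero (F G : FreeComplex k n) (i : ℕ) : sumMk F G i 0 0 = 0 :=
  map_zero (sumEquiv k n _ _).symm

theorem sum_d_sumMk (F G : FreeComplex k n) (i : ℕ) (x : F.obj (i + 1)) (y : G.obj (i + 1)) :
    (F.sum G).d i (sumMk F G (i + 1) x y) = sumMk F G i (F.d i x) (G.d i y) := by
  show (sumEquiv k n _ _).symm ((F.d i).prodMap (G.d i)
    (sumEquiv k n _ _ ((sumEquiv k n _ _).symm (x, y)))) = _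
  rw [LinearEquiv.apply_symm_apply]
  rfl

theorem ker_eq_range_of_forall {R A B C : Type*} [CommRing R] [AddCommGroup A] [Module R A]
    [AddCommGroup B] [Module R B] [AddCommGroup C] [Module R C] {f : A →ₗ[R] B} {g : B →ₗ[R] C}
    (h : g ∘ₗ f = 0) (h' : ∀ x, g x = 0 → ∃ y, f y = x) : LinearMap.ker g = LinearMap.range f :=
  le_antisymm (fun x hx => h' x hx) (LinearMap.range_le_ker_iff.2 h)

theorem exists_sumEquiv_symm {α β : Type} (z : α ⊕ β →₀ MvPolynomial (Fin n) k) :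
    ∃ x y, z = (sumEquiv k n α β).symm (x, y) :=
  ⟨_, _, ((sumEquiv k n α β).symm_apply_apply z).symm⟩

/-- If `φ x + d y = 0`, augmenting gives `ψ (εF x) = 0`. Injectivity of the map `ψ` of resolved
modules makes `x` a boundary; correcting `y` by the image of a bounding chain leaves a cycle of `G`.
-/
theorem ker_coneDZero {M N : Type*} [AddCommGroup M] [Module (MvPolynomial (Fin n) k) M]
    [AddCommGroup N] [Module (MvPolynomial (Fin n) k) N] (φ : Hom F G)
    (εF : F.obj 0 →ₗ[MvPolynomial (Fin n) k] M) (εG : G.obj 0 →ₗ[MvPolynomial (Fin n) k] N)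
    (hεF : LinearMap.ker εF = LinearMap.range (F.d 0)) (hεG : εG ∘ₗ G.d 0 = 0)
    (ψ : M →ₗ[MvPolynomial (Fin n) k] N) (hψ : Function.Injective ψ)
    (hφ : ∀ x, εG (φ.f 0 x) = ψ (εF x)) (hG : LinearMap.ker (G.d 0) = LinearMap.range (G.d 1)) :
    LinearMap.ker (coneDZero φ) = LinearMap.range (coneDSucc φ 0) := by
  refine ker_eq_range_of_forall (coneDZero_comp φ) fun z hz => ?_
  obtain ⟨x, y, rfl⟩ := exists_sumEquiv_symm z
  rw [coneDZero_symm] at hz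
  have hx : x ∈ LinearMap.range (F.d 0) := by
    rw [← hεF, LinearMap.mem_ker]
    apply hψ
    have := congrArg εG hz
    have h₀ : εG (G.d 0 y) = 0 := LinearMap.congr_fun hεG y
    rwa [map_add, h₀, add_zero, hφ, map_zero, ← map_zero ψ] at this
  obtain ⟨x', rfl⟩ := hx
  have hy : φ.f 1 x' + y ∈ LinearMap.range (G.d 1) := by
    rw [← hG, LinearMap.mem_ker, map_add, φ.d_f, hz]
  obtain ⟨y', hy'⟩ := hy
  refine ⟨(sumEquiv k n _ _).symm (-x', y'), ?_⟩
  rw [coneDSucc_symm]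
  simp [hy']

theorem ker_coneDSucc (φ : Hom F G) (i : ℕ)
    (hF : LinearMap.ker (F.d i) = LinearMap.range (F.d (i + 1)))
    (hG : LinearMap.ker (G.d (i + 1)) = LinearMap.range (G.d (i + 2))) :
    LinearMap.ker (coneDSucc φ i) = LinearMap.range (coneDSucc φ (i + 1)) := by
  refine ker_eq_range_of_forall (coneDSucc_comp φ i) fun z hz => ?_
  obtain ⟨x, y, rfl⟩ := exists_sumEquiv_symm z
  rw [coneDSucc_symm, LinearEquiv.map_eq_zero_iff, Prod.mk_eq_zero, neg_eq_zero] at hz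
  obtain ⟨hx, hz⟩ := hz
  rw [← LinearMap.mem_ker, hF] at hx
  obtain ⟨x', rfl⟩ := hx
  have hy : φ.f (i + 2) x' + y ∈ LinearMap.range (G.d (i + 2)) := by
    rw [← hG, LinearMap.mem_ker, map_add, φ.d_f, hz]
  obtain ⟨y', hy'⟩ := hy
  refine ⟨(sumEquiv k n _ _).symm (-x', y'), ?_⟩
  rw [coneDSucc_symm]
  simp [hy']

theorem sumEquiv_symm_mem_maxSMul {α β : Type} {x : α →₀ MvPolynomial (Fin n) k}
    {y : β →₀ MvPolynomial (Fin n) k} (hx : x ∈ maxSMul k n (α →₀ MvPolynomial (Fin n) k))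
    (hy : y ∈ maxSMul k n (β →₀ MvPolynomial (Fin n) k)) :
    (sumEquiv k n α β).symm (x, y) ∈ maxSMul k n (α ⊕ β →₀ MvPolynomial (Fin n) k) := by
  rw [mem_maxSMul_iff] at *
  rintro (b | b)
  · simpa [sumEquiv] using hx b
  · simpa [sumEquiv] using hy b

theorem IsMinimal.sum (hF : F.IsMinimal) (hG : G.IsMinimal) : (F.sum G).IsMinimal := by
  rintro i _ ⟨z, rfl⟩
  obtain ⟨x, y, rfl⟩ := exists_sumMk _ _ _ z
  rw [sum_d_sumMk]
  exact sumEquiv_symm_mem_maxSMul (hF i ⟨_, rfl⟩) (hG i ⟨_, rfl⟩)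

theorem IsMinimal.cone (hF : F.IsMinimal) (hG : G.IsMinimal) (φ : Hom F G)
    (hφ : ∀ i x, φ.f i x ∈ maxSMul k n (G.obj i)) : (cone φ).IsMinimal := by
  rintro (_ | i) _ ⟨z, rfl⟩
  · obtain ⟨x, y, rfl⟩ := exists_sumEquiv_symm z
    exact (coneDZero_symm φ x y).symm ▸ add_mem (hφ 0 x) (hG 0 ⟨_, rfl⟩)
  · obtain ⟨x, y, rfl⟩ := exists_sumEquiv_symm z
    exact (coneDSucc_symm φ i x y).symm ▸ sumEquiv_symm_mem_maxSMul
      (neg_mem (hF i ⟨_, rfl⟩)) (add_mem (hφ (i + 1) x) (hG (i + 1) ⟨_, rfl⟩))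

/-- A morphism that strictly lowers the degrees of basis elements has image in `𝔪 G`. -/
theorem Hom.mem_maxSMul_of_deg_lt (φ : Hom F G) (i : ℕ)
    (h : ∀ (b : F.ι i) (c : G.ι i), G.deg i c < F.deg i b) (x : F.obj i) :
    φ.f i x ∈ maxSMul k n (G.obj i) := by
  rw [← Finsupp.sum_single x, Finsupp.sum, map_sum]
  refine Submodule.sum_mem _ fun b _ => ?_
  have : Finsupp.single b (x b) = x b • Finsupp.single b (1 : MvPolynomial (Fin n) k) := by simp
  rw [this, map_smul]
  refine Submodule.smul_mem _ _ ((mem_maxSMul_iff _).2 fun c => ?_)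
  by_contra hc
  have h₁ := φ.f_homog i b c 0 (mem_support_iff.2 hc)
  have h₂ := h b c
  simp only [map_zero] at h₁
  omega

theorem isMinimal_single (e : ℕ) : (single k n e).IsMinimal := by
  rintro i _ ⟨z, rfl⟩
  exact zero_mem _

theorem isMinimal_zero : (zero k n).IsMinimal := by
  rintro i _ ⟨z, rfl⟩
  exact zero_mem _

end FreeComplex

open FreeComplex

/-- `F` is a minimal graded free resolution of the ideal `I` through the augmentation `ε`. -/
structure ResolvesIdeal (I : Ideal (MvPolynomial (Fin n) k)) (F : FreeComplex k n)
    (ε : F.obj 0 →ₗ[MvPolynomial (Fin n) k] MvPolynomial (Fin n) k) : Prop where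
  aug_homog : ∀ b, (ε (Finsupp.single b 1)).IsHomogeneous (F.deg 0 b)
  range_aug : LinearMap.range ε = I
  exact_zero : LinearMap.ker ε = LinearMap.range (F.d 0)
  exact_succ : ∀ i, LinearMap.ker (F.d i) = LinearMap.range (F.d (i + 1))
  minimal : F.IsMinimal

theorem resolvesIdeal_zero : ResolvesIdeal ⊥ (zero k n) 0 where
  aug_homog b := b.elim
  range_aug := by simp
  exact_zero := by
    have : Subsingleton ((zero k n).obj 0) := inferInstanceAs (Subsingleton (Empty →₀ _))
    exact Subsingleton.elim _ _
  exact_succ i := by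
    have : Subsingleton ((zero k n).obj (i + 1)) := inferInstanceAs (Subsingleton (Empty →₀ _))
    exact Subsingleton.elim _ _
  minimal := isMinimal_zero

variable {F F' : FreeComplex k n}
  {ε : F.obj 0 →ₗ[MvPolynomial (Fin n) k] MvPolynomial (Fin n) k}
  {ε' : F'.obj 0 →ₗ[MvPolynomial (Fin n) k] MvPolynomial (Fin n) k}
  {g : Fin n →₀ ℕ} {I : Ideal (MvPolynomial (Fin n) k)}

theorem linearCombination_unit {R : Type*} [CommRing R] (c : R) (x : Unit →₀ R) :
    Finsupp.linearCombination R (fun _ : Unit => c) x = x () * c := by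
  rw [Finsupp.linearCombination_unique]
  rfl

/-- The element `(x, c)` of `F_0 ⊕ S(-e)`. -/
noncomputable def pairMk (F : FreeComplex k n) (e : ℕ) (x : F.obj 0)
    (c : MvPolynomial (Fin n) k) : (F.sum (single k n e)).obj 0 :=
  (sumEquiv k n (F.ι 0) Unit).symm (x, Finsupp.single () c)

theorem exists_pairMk {e : ℕ} (z : (F.sum (single k n e)).obj 0) :
    ∃ x c, z = pairMk F e x c := by
  refine ⟨(sumEquiv k n (F.ι 0) Unit z).1, (sumEquiv k n (F.ι 0) Unit z).2 (), ?_⟩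
  rw [pairMk, Finsupp.unique_single (sumEquiv k n (F.ι 0) Unit z).2]
  simp only [Finsupp.single_eq_same]
  rw [← Finsupp.unique_single (sumEquiv k n (F.ι 0) Unit z).2]
  exact ((sumEquiv k n (F.ι 0) Unit).symm_apply_apply z).symm

theorem pairMk_injective {e : ℕ} {x x' : F.obj 0} {c c' : MvPolynomial (Fin n) k}
    (h : pairMk F e x c = pairMk F e x' c') : x = x' ∧ c = c' := by
  obtain ⟨h₁, h₂⟩ := Prod.mk.inj ((sumEquiv k n (F.ι 0) Unit).symm.injective h)
  exact ⟨h₁, Finsupp.single_injective _ h₂⟩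

theorem sum_single_d_zero {e : ℕ} (x : F.obj 1) (y : (single k n e).obj 1) :
    (F.sum (single k n e)).d 0 (sumMk F _ 1 x y) = pairMk F e (F.d 0 x) 0 := by
  rw [sum_d_sumMk, pairMk, Finsupp.single_zero]
  rfl

theorem coneAug_pairMk (x : F.obj 0) (c : MvPolynomial (Fin n) k) :
    coneAug F ε g (pairMk F _ x c) = ε x + c * mono k g := by
  show ε.coprod (Finsupp.linearCombination (MvPolynomial (Fin n) k) (fun _ : Unit => mono k g))
    (sumEquiv k n (F.ι 0) Unit ((sumEquiv k n (F.ι 0) Unit).symm (x, Finsupp.single () c))) = _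
  rw [LinearEquiv.apply_symm_apply, LinearMap.coprod_apply, linearCombination_unit,
    Finsupp.single_eq_same]

/-- The augmentation `ε ⊕ y^g` of `F ⊕ S(-|g|)`. -/
noncomputable def pairAug (F : FreeComplex k n)
    (ε : F.obj 0 →ₗ[MvPolynomial (Fin n) k] MvPolynomial (Fin n) k) (g : Fin n →₀ ℕ) :
    (F.sum (single k n g.degree)).obj 0 →ₗ[MvPolynomial (Fin n) k]
      MvPolynomial (Fin n) k × MvPolynomial (Fin n) k :=
  (ε.prodMap (Finsupp.linearCombination (MvPolynomial (Fin n) k) (fun _ : Unit => mono k g))) ∘ₗ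
    (sumEquiv k n (F.ι 0) Unit).toLinearMap

theorem pairAug_apply (z : (F.sum (single k n g.degree)).obj 0) :
    pairAug F ε g z = (ε (sumEquiv k n (F.ι 0) Unit z).1,
      (sumEquiv k n (F.ι 0) Unit z).2 () * mono k g) := by
  rw [← linearCombination_unit]
  rfl

theorem pairAug_pairMk (x : F.obj 0) (c : MvPolynomial (Fin n) k) :
    pairAug F ε g (pairMk F _ x c) = (ε x, c * mono k g) := by
  rw [pairAug_apply]
  simp only [pairMk]
  rw [LinearEquiv.apply_symm_apply, Finsupp.single_eq_same]

theorem mono_ne_zero (g : Fin n →₀ ℕ) : mono k g ≠ 0 := by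
  simp [mono, monomial_eq_zero]

instance subsingleton_single_obj_succ (e i : ℕ) : Subsingleton ((single k n e).obj (i + 1)) :=
  inferInstanceAs (Subsingleton (Empty →₀ _))

/-- The module `I ⊕ ⟨y^g⟩` is realised inside `S × S`. The second summand adds no relations because
`S` is a domain. -/
theorem ResolvesIdeal.ker_pairAug (hF : ResolvesIdeal I F ε) :
    LinearMap.ker (pairAug F ε g) = LinearMap.range ((F.sum (single k n g.degree)).d 0) := by
  ext z
  obtain ⟨x, c, rfl⟩ := exists_pairMk z
  rw [LinearMap.mem_ker, pairAug_pairMk, Prod.mk_eq_zero, mul_eq_zero,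
    or_iff_left (mono_ne_zero g), ← LinearMap.mem_ker, hF.exact_zero]
  constructor
  · rintro ⟨⟨x', rfl⟩, rfl⟩
    exact ⟨sumMk _ _ _ x' 0, sum_single_d_zero _ _⟩
  · rintro ⟨z, hz⟩
    obtain ⟨x', y', rfl⟩ := exists_sumMk _ _ _ z
    obtain ⟨rfl, rfl⟩ := pairMk_injective ((sum_single_d_zero x' y').symm.trans hz)
    exact ⟨⟨x', rfl⟩, rfl⟩

theorem ResolvesIdeal.ker_sum_d (hF : ResolvesIdeal I F ε) (e i : ℕ) :
    LinearMap.ker ((F.sum (single k n e)).d i) =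
      LinearMap.range ((F.sum (single k n e)).d (i + 1)) := by
  refine ker_eq_range_of_forall ((F.sum (single k n e)).d_comp_d i) fun z hz => ?_
  obtain ⟨x, y, rfl⟩ := exists_sumMk _ _ _ z
  rw [sum_d_sumMk, ← sumMk_zero] at hz
  have hx := (sumMk_injective hz).1
  rw [← LinearMap.mem_ker, hF.exact_succ] at hx
  obtain ⟨x', rfl⟩ := hx
  exact ⟨sumMk _ _ _ x' 0, by rw [sum_d_sumMk, map_zero, Subsingleton.elim y 0]⟩

theorem isHomog_pairMk {e e' : ℕ} {x : F.obj 0} {c : MvPolynomial (Fin n) k}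
    (hx : IsHomog (F.deg 0) e' x) (hc : ∀ w ∈ c.support, w.degree + e = e') :
    IsHomog ((F.sum (single k n e)).deg 0) e' (pairMk F e x c) := by
  refine isHomog_sumEquiv_symm (deg₂ := fun _ : Unit => e) hx fun u w hw => ?_
  rw [Finsupp.single_eq_same] at hw
  exact hc w hw

theorem degree_add_eq_of_mul_mono {c p : MvPolynomial (Fin n) k} {e : ℕ}
    (hc : c * mono k g = p) (hp : p.IsHomogeneous e) {w : Fin n →₀ ℕ} (hw : w ∈ c.support) :
    w.degree + g.degree = e := by
  have h : w + g ∈ p.support := by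
    rw [mem_support_iff, ← hc, mono, coeff_mul_monomial, mul_one]
    exact mem_support_iff.1 hw
  rw [← map_add, hp.degree_eq_sum_deg_support h]
  rfl

theorem isGrading_homogeneousSubmodule (k : Type u) [Field k] (n : ℕ) :
    IsGrading (n := n) (homogeneousSubmodule (Fin n) k) where
  smul_mem hp hx := hp.mul hx
  exists_proj e := ⟨(homogeneousComponent e).toAddMonoidHom,
    fun _ hx => homogeneousComponent_eq_self hx,
    fun _ he' _ hx => (homogeneousComponent_of_mem hx).trans (if_neg he'.symm)⟩

/-- The comparison theorem is applied to `(ε', -ε')` over `pairAug`. Only the homogeneous preimages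
of the basis elements in homological degree `0` have to be supplied. -/
theorem ResolvesIdeal.exists_liftsInclusion (hF : ResolvesIdeal I F ε)
    (hF' : ResolvesIdeal (I ⊓ Ideal.span {mono k g}) F' ε') :
    ∃ φ : F'.Hom (F.sum (single k n g.degree)), LiftsInclusion ε' ε g φ := by
  have hε' : ∀ x, ε' (F'.d 0 x) = 0 := fun x => by
    rw [← LinearMap.mem_ker, hF'.exact_zero]
    exact ⟨x, rfl⟩
  obtain ⟨φ, hφ⟩ := exists_hom_lift F' (F.sum (single k n g.degree)) (ε'.prod (-ε'))
    (pairAug F ε g) (LinearMap.ext fun x => by simp [hε']) hF.ker_pairAug (hF.ker_sum_d _)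
    fun b => by
      have hb : ε' (Finsupp.single b 1) ∈ I ⊓ Ideal.span {mono k g} := by
        rw [← hF'.range_aug]
        exact ⟨_, rfl⟩
      have hh := hF'.aug_homog b
      obtain ⟨h₁, h₂⟩ := hb
      rw [← hF.range_aug] at h₁
      obtain ⟨x, hx⟩ := h₁
      obtain ⟨c, hc⟩ := Ideal.mem_span_singleton'.1 h₂
      obtain ⟨x', hx', hx''⟩ := (isGrading_homogeneousSubmodule k n).exists_homog_preimage ε
        hF.aug_homog x (hx.symm ▸ hh)
      refine ⟨pairMk F _ x' (-c), isHomog_pairMk hx' fun w hw => ?_, ?_⟩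
      · refine degree_add_eq_of_mul_mono hc hh (by simpa using hw)
      · rw [pairAug_pairMk, hx'', hx, neg_mul, hc]
        rfl
  refine ⟨φ, fun x => ?_⟩
  have := LinearMap.congr_fun hφ x
  rw [LinearMap.comp_apply, pairAug_apply] at this
  exact ⟨congrArg Prod.fst this, congrArg Prod.snd this⟩

theorem LiftsInclusion.pairAug_f {φ : F'.Hom (F.sum (single k n g.degree))}
    (hφ : LiftsInclusion ε' ε g φ) (x : F'.obj 0) :
    pairAug F ε g (φ.f 0 x) = (ε' x, -ε' x) := by
  rw [pairAug_apply, (hφ x).1, (hφ x).2]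

/-- This is the cone over the short exact sequence `0 → I ∩ ⟨y^g⟩ → I ⊕ ⟨y^g⟩ → I + ⟨y^g⟩ → 0`. -/
theorem ResolvesIdeal.cone (hF : ResolvesIdeal I F ε)
    (hF' : ResolvesIdeal (I ⊓ Ideal.span {mono k g}) F' ε')
    (φ : F'.Hom (F.sum (single k n g.degree))) (hφ : LiftsInclusion ε' ε g φ)
    (hmin : ∀ i x, φ.f i x ∈ maxSMul k n ((F.sum (single k n g.degree)).obj i)) :
    ResolvesIdeal (I ⊔ Ideal.span {mono k g}) (cone φ) (coneAug F ε g) where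
  aug_homog b := by
    rcases b with b | b
    · have h : pairMk F g.degree (Finsupp.single b 1) 0 = Finsupp.single (Sum.inl b) 1 := by
        refine (sumEquiv k n (F.ι 0) Unit).symm_apply_eq.2 ?_
        rw [Finsupp.single_zero]
        exact (sumEquiv_single_inl b 1).symm
      have h' := coneAug_pairMk (ε := ε) (g := g) (Finsupp.single b 1) 0
      rw [zero_mul, add_zero, h] at h'
      exact h'.symm ▸ hF.aug_homog b
    · have h : pairMk F g.degree 0 1 = Finsupp.single (Sum.inr b) 1 :=
        (sumEquiv k n (F.ι 0) Unit).symm_apply_eq.2 (sumEquiv_single_inr _ 1).symm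
      have h' := coneAug_pairMk (ε := ε) (g := g) 0 1
      rw [map_zero, one_mul, zero_add, h] at h'
      exact h'.symm ▸ isHomogeneous_monomial _ rfl
  range_aug := by
    ext p
    rw [Submodule.mem_sup, ← hF.range_aug]
    constructor
    · rintro ⟨z, rfl⟩
      obtain ⟨x, c, rfl⟩ := exists_pairMk z
      exact ⟨_, ⟨x, rfl⟩, _, Ideal.mem_span_singleton'.2 ⟨c, rfl⟩, (coneAug_pairMk x c).symm⟩
    · rintro ⟨_, ⟨x, rfl⟩, q, hq, rfl⟩
      obtain ⟨c, rfl⟩ := Ideal.mem_span_singleton'.1 hq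
      exact ⟨pairMk F _ x c, coneAug_pairMk _ _⟩
  exact_zero := by
    refine ker_eq_range_of_forall (f := coneDZero φ) (g := coneAug F ε g) ?_ fun z hz => ?_
    · refine LinearMap.ext fun z => ?_
      obtain ⟨w, v, rfl⟩ := exists_sumEquiv_symm z
      obtain ⟨x, y, rfl⟩ := exists_sumMk _ _ _ v
      obtain ⟨x', c, h⟩ := exists_pairMk (φ.f 0 w)
      have hε : ε (F.d 0 x) = 0 := by
        rw [← LinearMap.mem_ker, hF.exact_zero]
        exact ⟨x, rfl⟩
      have hw := hφ.pairAug_f w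
      rw [h, pairAug_pairMk, Prod.mk.injEq] at hw
      rw [LinearMap.comp_apply, coneDZero_symm, map_add, h, coneAug_pairMk, sum_single_d_zero,
        coneAug_pairMk, hε, hw.1, hw.2]
      simp
    · obtain ⟨x, c, rfl⟩ := exists_pairMk z
      rw [coneAug_pairMk] at hz
      -- A relation `ε x + c y^g = 0` says that `ε x = -c y^g` lies in the intersection. It comes
      -- from some `w`, and `(x, c) - φ w` is then killed by `pairAug`, hence a boundary.
      have hx : ε x ∈ I ⊓ Ideal.span {mono k g} := by
        refine ⟨hF.range_aug ▸ ⟨x, rfl⟩, Ideal.mem_span_singleton'.2 ⟨-c, ?_⟩⟩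
        rw [neg_mul, eq_comm, eq_neg_iff_add_eq_zero, hz]
      rw [← hF'.range_aug] at hx
      obtain ⟨w, hw⟩ := hx
      have h₀ : pairMk F _ x c - φ.f 0 w ∈
          LinearMap.range ((F.sum (single k n g.degree)).d 0) := by
        rw [← hF.ker_pairAug, LinearMap.mem_ker, map_sub, pairAug_pairMk, hφ.pairAug_f,
          hw, Prod.mk_sub_mk, sub_self, sub_neg_eq_add, add_comm, hz]
        rfl
      obtain ⟨v, hv⟩ := h₀
      refine ⟨(sumEquiv k n _ _).symm (w, v), ?_⟩
      rw [coneDZero_symm, hv, add_sub_cancel]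
  exact_succ i := by
    rcases i with _ | i
    · refine ker_coneDZero φ ε' (pairAug F ε g) hF'.exact_zero ?_
        (LinearMap.id.prod (-LinearMap.id)) (fun x y h => congrArg Prod.fst h) (fun x => ?_)
        (hF.ker_sum_d _ _)
      · exact LinearMap.range_le_ker_iff.1 hF.ker_pairAug.ge
      · exact hφ.pairAug_f x
    · exact ker_coneDSucc φ i (hF'.exact_succ i) (hF.ker_sum_d _ _)
  minimal := hF'.minimal.cone (hF.minimal.sum (isMinimal_single _)) φ hmin

end Cone
-- Adding one generator, and resolving shifted complete intersections.
section Construction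

variable {k : Type u} [Field k] {n : ℕ}

open FreeComplex

theorem mem_monomialSpan_iff (L : List (Fin n →₀ ℕ)) (p : MvPolynomial (Fin n) k) :
    p ∈ monomialSpan k L ↔ ∀ w ∈ p.support, ∃ a ∈ L, a ≤ w := by
  have : {p : MvPolynomial (Fin n) k | ∃ a ∈ L, p = mono k a} =
      (fun s => monomial s (1 : k)) '' {a | a ∈ L} := by
    ext p
    simp [mono, eq_comm]
  rw [monomialSpan, this, mem_ideal_span_monomial_image]
  rfl

theorem monomialSpan_nil : monomialSpan k ([] : List (Fin n →₀ ℕ)) = ⊥ := by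
  simp [monomialSpan]

theorem monomialSpan_cons (g : Fin n →₀ ℕ) (L : List (Fin n →₀ ℕ)) :
    monomialSpan k (g :: L) = monomialSpan k L ⊔ Ideal.span {mono k g} := by
  rw [monomialSpan, monomialSpan, ← Ideal.span_union]
  congr 1
  ext p
  simp

theorem span_mono_eq (g : Fin n →₀ ℕ) : Ideal.span {mono k g} = monomialSpan k [g] := by
  simp [monomialSpan]

/-- Membership in a monomial ideal is tested monomial by monomial, so intersections reduce to
divisibility of exponents. -/
theorem monomialSpan_inf_span_mono {L L' : List (Fin n →₀ ℕ)} {g : Fin n →₀ ℕ}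
    (h : ∀ u, ((∃ a ∈ L, a ≤ u) ∧ g ≤ u) ↔ ∃ a ∈ L', a ≤ u) :
    monomialSpan k L ⊓ Ideal.span {mono k g} = monomialSpan k L' := by
  ext p
  rw [span_mono_eq, Ideal.mem_inf, mem_monomialSpan_iff, mem_monomialSpan_iff,
    mem_monomialSpan_iff, ← forall₂_and]
  simp [← h]

/-- The complex `F` is, through `ε`, an iterated mapping cone resolution for the list `L` of
minimal monomial generators, and it is a minimal free resolution of the ideal they generate. -/
structure IsConeResolution (L : List (Fin n →₀ ℕ)) (F : FreeComplex k n)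
    (ε : F.obj 0 →ₗ[MvPolynomial (Fin n) k] MvPolynomial (Fin n) k) : Prop where
  isCone : IsIteratedMappingCone L F ε
  resolves : ResolvesIdeal (monomialSpan k L) F ε
  pairwise : L.Pairwise (fun a b => ¬ a ≤ b ∧ ¬ b ≤ a)

theorem isConeResolution_nil : IsConeResolution [] (zero k n) 0 where
  isCone := .nil
  resolves := monomialSpan_nil (k := k) (n := n) ▸ resolvesIdeal_zero
  pairwise := .nil

/-- `F_i` has a basis element of degree `e`. -/
def FreeComplex.HasDeg (F : FreeComplex k n) (i e : ℕ) : Prop := ∃ b, F.deg i b = e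

theorem FreeComplex.not_hasDeg_zero (i e : ℕ) : ¬ (zero k n).HasDeg i e :=
  fun ⟨b, _⟩ => Empty.elim b

theorem FreeComplex.rank_zero (i : ℕ) : (zero k n).rank i = 0 :=
  Nat.card_of_isEmpty (α := Empty)

/-- Adding one generator by a mapping cone yields a minimal resolution as soon as the degrees in
the resolution of the intersection exceed those in the resolution of the previous ideal. -/
theorem IsConeResolution.exists_cons {L L' : List (Fin n →₀ ℕ)} {g : Fin n →₀ ℕ}
    {F F' : FreeComplex k n}
    {ε : F.obj 0 →ₗ[MvPolynomial (Fin n) k] MvPolynomial (Fin n) k}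
    {ε' : F'.obj 0 →ₗ[MvPolynomial (Fin n) k] MvPolynomial (Fin n) k}
    (hF : IsConeResolution L F ε) (hF' : IsConeResolution L' F' ε')
    (hg : ∀ b ∈ L, ¬ g ≤ b ∧ ¬ b ≤ g)
    (hinf : ∀ u, ((∃ a ∈ L, a ≤ u) ∧ g ≤ u) ↔ ∃ a ∈ L', a ≤ u)
    (hdeg : ∀ i e e', F.HasDeg i e → F'.HasDeg i e' → e < e')
    (hdeg' : ∀ e', F'.HasDeg 0 e' → g.degree < e') :
    ∃ (G : FreeComplex k n)
      (η : G.obj 0 →ₗ[MvPolynomial (Fin n) k] MvPolynomial (Fin n) k),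
      IsConeResolution (g :: L) G η ∧ G.rank 0 = F.rank 0 + 1 ∧
      (∀ i, G.rank (i + 1) = F'.rank i + F.rank (i + 1)) ∧
      (∀ e, G.HasDeg 0 e ↔ F.HasDeg 0 e ∨ g.degree = e) ∧
      ∀ i e, G.HasDeg (i + 1) e ↔ F'.HasDeg i e ∨ F.HasDeg (i + 1) e := by
  have hI := monomialSpan_inf_span_mono (k := k) hinf
  have hR : ResolvesIdeal (monomialSpan k L ⊓ Ideal.span {mono k g}) F' ε' :=
    hI.symm ▸ hF'.resolves
  obtain ⟨φ, hφ⟩ := hF.resolves.exists_liftsInclusion hR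
  have hp : (g :: L).Pairwise (fun a b => ¬ a ≤ b ∧ ¬ b ≤ a) :=
    List.pairwise_cons.2 ⟨hg, hF.pairwise⟩
  refine ⟨cone φ, coneAug F ε g, ⟨?_, ?_, hp⟩, ?_, fun i => ?_, fun e => ?_, fun i e => ?_⟩
  · exact .cons g L L' F F' ε ε' φ hF.isCone hF'.isCone ⟨rfl, hp⟩ ⟨hI, hF'.pairwise⟩ hφ
  · rw [monomialSpan_cons]
    -- Minimality uses degrees only and nothing about the particular lift `φ`. The summand `S(-|g|)`
    -- matters in homological degree `0` alone.
    refine hF.resolves.cone hR φ hφ fun i => φ.mem_maxSMul_of_deg_lt i ?_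
    rintro b (c | c)
    · exact hdeg i _ _ ⟨c, rfl⟩ ⟨b, rfl⟩
    · rcases i with _ | i
      · exact hdeg' _ ⟨b, rfl⟩
      · exact Empty.elim c
  · have := F.fin 0
    show Nat.card (F.ι 0 ⊕ Unit) = _
    rw [Nat.card_sum, Nat.card_unique (α := Unit)]
    rfl
  · have := F.fin (i + 1)
    have := F'.fin i
    show Nat.card (F'.ι i ⊕ (F.ι (i + 1) ⊕ Empty)) = _
    rw [Nat.card_sum, Nat.card_sum, Nat.card_of_isEmpty (α := Empty)]
    rfl
  · constructor
    · rintro ⟨b | b, rfl⟩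
      · exact Or.inl ⟨b, rfl⟩
      · exact Or.inr rfl
    · rintro (⟨b, rfl⟩ | rfl)
      · exact ⟨Sum.inl b, rfl⟩
      · exact ⟨Sum.inr (), rfl⟩
  · constructor
    · rintro ⟨b | b | b, rfl⟩
      · exact Or.inl ⟨b, rfl⟩
      · exact Or.inr ⟨b, rfl⟩
      · exact Empty.elim b
    · rintro (⟨b, rfl⟩ | ⟨b, rfl⟩)
      · exact ⟨Sum.inl b, rfl⟩
      · exact ⟨Sum.inr (Sum.inl b), rfl⟩

theorem exists_isConeResolution_singleton (g : Fin n →₀ ℕ) :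
    ∃ (G : FreeComplex k n)
      (η : G.obj 0 →ₗ[MvPolynomial (Fin n) k] MvPolynomial (Fin n) k),
      IsConeResolution [g] G η ∧ G.rank 0 = 1 ∧ (∀ i, G.rank (i + 1) = 0) ∧
      (∀ e, G.HasDeg 0 e ↔ g.degree = e) ∧ ∀ i e, ¬ G.HasDeg (i + 1) e := by
  obtain ⟨G, η, h, h₀, h₁, h₂, h₃⟩ := (isConeResolution_nil (k := k) (n := n)).exists_cons (g := g)
    isConeResolution_nil (by simp) (by simp) (fun i e e' h => (not_hasDeg_zero i e h).elim)
    (fun e' h => (not_hasDeg_zero _ _ h).elim)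
  exact ⟨G, η, h, by simp [h₀, FreeComplex.rank_zero], fun i => by simp [h₁, FreeComplex.rank_zero],
    fun e => by simp [h₂, not_hasDeg_zero], fun i e => by simp [h₃, not_hasDeg_zero]⟩

theorem add_single_le_iff {ι : Type*} {h u : ι →₀ ℕ} {i : ι} {a : ℕ} :
    h + Finsupp.single i a ≤ u ↔ h ≤ u ∧ h i + a ≤ u i := by
  classical
  constructor
  · intro H
    exact ⟨le_trans le_self_add H, by simpa using H i⟩
  · rintro ⟨h₁, h₂⟩ j
    rw [Finsupp.add_apply, Finsupp.single_apply]
    split_ifs with hij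
    · exact hij ▸ h₂
    · simpa using h₁ j

theorem ofNat_eq_ofNat_iff [NeZero n] {i j : ℕ} (hi : i < n) (hj : j < n) :
    Fin.ofNat n i = Fin.ofNat n j ↔ i = j := by
  simp [Fin.ext_iff, Fin.ofNat, Nat.mod_eq_of_lt hi, Nat.mod_eq_of_lt hj]

/-- The exponents of the monomials `y^h y_0`, `y^h y_1^a`, …, `y^h y_r^a` (the last one first,
and the variables numbered from `0`). -/
noncomputable def powersList [NeZero n] (h : Fin n →₀ ℕ) (a : ℕ) : ℕ → List (Fin n →₀ ℕ)
  | 0 => [h + Finsupp.single (Fin.ofNat n 0) 1]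
  | r + 1 => (h + Finsupp.single (Fin.ofNat n (r + 1)) a) :: powersList h a r

theorem mem_powersList [NeZero n] {h c : Fin n →₀ ℕ} {a r : ℕ} :
    c ∈ powersList h a r ↔ c = h + Finsupp.single (Fin.ofNat n 0) 1 ∨
      ∃ j, 1 ≤ j ∧ j ≤ r ∧ c = h + Finsupp.single (Fin.ofNat n j) a := by
  induction r with
  | zero =>
    rw [powersList, List.mem_singleton]
    refine ⟨Or.inl, ?_⟩
    rintro (h | ⟨j, h₁, h₂, -⟩)
    · exact h
    · omega
  | succ r ih =>
    rw [powersList, List.mem_cons, ih]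
    constructor
    · rintro (h | h | ⟨j, h₁, h₂, h⟩)
      · exact Or.inr ⟨r + 1, by omega, le_rfl, h⟩
      · exact Or.inl h
      · exact Or.inr ⟨j, h₁, by omega, h⟩
    · rintro (h | ⟨j, h₁, h₂, h⟩)
      · exact Or.inr (Or.inl h)
      · rcases eq_or_lt_of_le h₂ with rfl | h₂
        · exact Or.inl h
        · exact Or.inr (Or.inr ⟨j, h₁, by omega, h⟩)

theorem exists_mem_powersList_le [NeZero n] {h u : Fin n →₀ ℕ} {a r : ℕ} :
    (∃ c ∈ powersList h a r, c ≤ u) ↔ h ≤ u ∧ (h (Fin.ofNat n 0) + 1 ≤ u (Fin.ofNat n 0) ∨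
      ∃ j, 1 ≤ j ∧ j ≤ r ∧ h (Fin.ofNat n j) + a ≤ u (Fin.ofNat n j)) := by
  constructor
  · rintro ⟨c, hc, hcu⟩
    rcases mem_powersList.1 hc with rfl | ⟨j, h₁, h₂, rfl⟩
    · rw [add_single_le_iff] at hcu
      exact ⟨hcu.1, Or.inl hcu.2⟩
    · rw [add_single_le_iff] at hcu
      exact ⟨hcu.1, Or.inr ⟨j, h₁, h₂, hcu.2⟩⟩
  · rintro ⟨h₁, h₂ | ⟨j, h₂, h₃, h₄⟩⟩
    · exact ⟨_, mem_powersList.2 (Or.inl rfl), add_single_le_iff.2 ⟨h₁, h₂⟩⟩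
    · exact ⟨_, mem_powersList.2 (Or.inr ⟨j, h₂, h₃, rfl⟩), add_single_le_iff.2 ⟨h₁, h₄⟩⟩

theorem not_add_single_le_add_single {ι : Type*} {h : ι →₀ ℕ} {i j : ι} {a b : ℕ} (hij : i ≠ j)
    (ha : a ≠ 0) : ¬ h + Finsupp.single i a ≤ h + Finsupp.single j b := by
  intro H
  have := H i
  simp [Finsupp.single_eq_of_ne hij, ha] at this

/-- The minimal resolution of `y^h ⟨y_0, y_1^a, …, y_r^a⟩` by iterated mapping cones. -/
theorem exists_isConeResolution_powersList [NeZero n] {a : ℕ} (ha : 1 ≤ a) {r : ℕ} (hr : r < n)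
    (h : Fin n →₀ ℕ) :
    ∃ (F : FreeComplex k n)
      (ε : F.obj 0 →ₗ[MvPolynomial (Fin n) k] MvPolynomial (Fin n) k),
      IsConeResolution (powersList h a r) F ε ∧ (∀ i, F.rank i = (r + 1).choose (i + 1)) ∧
      (∀ i e, F.HasDeg i e → h.degree + 1 + i * a ≤ e ∧ e ≤ h.degree + (i + 1) * a ∧
        e + r ≤ h.degree + r * a + i + 1) ∧
      F.HasDeg r (h.degree + 1 + r * a) := by
  induction r generalizing h with
  | zero =>
    obtain ⟨F, ε, h₀, h₁, h₂, h₃, h₄⟩ := exists_isConeResolution_singleton (k := k)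
      (h + Finsupp.single (Fin.ofNat n 0) 1)
    rw [map_add, Finsupp.degree_single] at h₃
    refine ⟨F, ε, h₀, ?_, ?_, ?_⟩
    · rintro (_ | i)
      · rw [h₁]; rfl
      · rw [h₂, Nat.choose_eq_zero_of_lt (by omega)]
    · rintro (_ | i) e he
      · rw [h₃] at he
        omega
      · exact (h₄ _ _ he).elim
    · simp [h₃]
  | succ r ih =>
    obtain ⟨F, ε, h₀, h₁, h₂, h₃⟩ := ih (by omega) h
    -- The intersection with the new generator is the same list multiplied by `y_{r+1}^a`, so the
    -- induction hypothesis applies with a larger `h`.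
    obtain ⟨F', ε', h₀', h₁', h₂', h₃'⟩ := ih (by omega)
      (h + Finsupp.single (Fin.ofNat n (r + 1)) a)
    rw [map_add, Finsupp.degree_single] at h₂' h₃'
    have hg : ∀ c ∈ powersList h a r, ¬ h + Finsupp.single (Fin.ofNat n (r + 1)) a ≤ c ∧
        ¬ c ≤ h + Finsupp.single (Fin.ofNat n (r + 1)) a := by
      intro c hc
      have key : ∀ j, j ≤ r → Fin.ofNat n (r + 1) ≠ Fin.ofNat n j := fun j hj => by
        rw [Ne, ofNat_eq_ofNat_iff hr (by omega)]
        omega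
      rcases mem_powersList.1 hc with rfl | ⟨j, hj, hj', rfl⟩
      · exact ⟨not_add_single_le_add_single (key 0 (by omega)) (by omega),
          not_add_single_le_add_single (key 0 (by omega)).symm (by omega)⟩
      · exact ⟨not_add_single_le_add_single (key j hj') (by omega),
          not_add_single_le_add_single (key j hj').symm (by omega)⟩
    have hinf : ∀ u, ((∃ c ∈ powersList h a r, c ≤ u) ∧
        h + Finsupp.single (Fin.ofNat n (r + 1)) a ≤ u) ↔
        ∃ c ∈ powersList (h + Finsupp.single (Fin.ofNat n (r + 1)) a) a r, c ≤ u := by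
      intro u
      have key : ∀ j, j ≤ r → (h + Finsupp.single (Fin.ofNat n (r + 1)) a) (Fin.ofNat n j) =
          h (Fin.ofNat n j) := fun j hj => by
        rw [Finsupp.add_apply, Finsupp.single_eq_of_ne, add_zero]
        rw [Ne, ofNat_eq_ofNat_iff (by omega) hr]
        omega
      rw [exists_mem_powersList_le, exists_mem_powersList_le, key 0 (by omega)]
      constructor
      · rintro ⟨⟨-, h₁ | ⟨j, hj, hj', h₁⟩⟩, h₂⟩
        · exact ⟨h₂, Or.inl h₁⟩
        · exact ⟨h₂, Or.inr ⟨j, hj, hj', by rwa [key j hj']⟩⟩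
      · rintro ⟨h₂, h₁ | ⟨j, hj, hj', h₁⟩⟩
        · exact ⟨⟨(add_single_le_iff.1 h₂).1, Or.inl h₁⟩, h₂⟩
        · exact ⟨⟨(add_single_le_iff.1 h₂).1, Or.inr ⟨j, hj, hj', by rwa [key j hj'] at h₁⟩⟩, h₂⟩
    -- Here `e ≤ |h| + (i+1)a`, while `e' ≥ (|h| + a) + 1 + ia`.
    have hdeg : ∀ i e e', F.HasDeg i e → F'.HasDeg i e' → e < e' := by
      intro i e e' he he'
      have h₁ := h₂ _ _ he
      have h₂ := h₂' _ _ he'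
      simp only [add_mul, one_mul] at h₁ h₂
      omega
    have hdeg' : ∀ e', F'.HasDeg 0 e' →
        (h + Finsupp.single (Fin.ofNat n (r + 1)) a).degree < e' := by
      intro e' he'
      have h₂ := h₂' _ _ he'
      rw [map_add, Finsupp.degree_single]
      omega
    obtain ⟨G, η, g₀, g₁, g₂, g₃, g₄⟩ := h₀.exists_cons h₀' hg hinf hdeg hdeg'
    rw [map_add, Finsupp.degree_single] at g₃
    refine ⟨G, η, g₀, ?_, ?_, ?_⟩
    · rintro (_ | i)
      · rw [g₁, h₁]
        simp
      · rw [g₂, h₁, h₁', Nat.choose_succ_succ' (r + 1)]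
    · have hra : r ≤ r * a := Nat.le_mul_of_pos_right r ha
      rintro (_ | i) e he
      · rcases (g₃ e).1 he with he | rfl
        · have := h₂ _ _ he
          simp only [add_mul, one_mul, zero_mul] at this ⊢
          omega
        · simp only [add_mul, one_mul, zero_mul]
          omega
      · rcases (g₄ i e).1 he with he | he
        · have := h₂' _ _ he
          simp only [add_mul, one_mul] at this ⊢
          omega
        · have := h₂ _ _ he
          simp only [add_mul, one_mul] at this ⊢
          omega
    -- The top degree is inherited from the top of the resolution of the intersection.
    · refine (g₄ r _).2 (Or.inl ?_)
      convert h₃' using 1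
      ring

end Construction
-- The generators of the ideal in order, and its iterated mapping cone.
section LinesIdeal

variable {k : Type u} [Field k] {n : ℕ} [NeZero n]

open FreeComplex

/-- The exponent of `y_0^{m - a} y_j^a` (with the variables numbered from `0`). -/
noncomputable def lineGen (n : ℕ) [NeZero n] (m a j : ℕ) : Fin n →₀ ℕ :=
  Finsupp.single (Fin.ofNat n 0) (m - a) + Finsupp.single (Fin.ofNat n j) a

/-- The list `L` preceded by the exponents of `y_0^{m - a} y_j^a` for `r ≥ j ≥ 1`. -/
noncomputable def lineRow (n : ℕ) [NeZero n] (L : List (Fin n →₀ ℕ)) (m a : ℕ) :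
    ℕ → List (Fin n →₀ ℕ)
  | 0 => L
  | r + 1 => lineGen n m a (r + 1) :: lineRow n L m a r

/-- The exponents of `y_0^m` and `y_0^{m - b} y_j^b`, for `1 ≤ b ≤ a` and `1 ≤ j ≤ n - 1`. -/
noncomputable def lineList (n : ℕ) [NeZero n] (m : ℕ) : ℕ → List (Fin n →₀ ℕ)
  | 0 => [Finsupp.single (Fin.ofNat n 0) m]
  | a + 1 => lineRow n (lineList n m a) m (a + 1) (n - 1)

theorem mem_lineRow {L : List (Fin n →₀ ℕ)} {m a r : ℕ} {c : Fin n →₀ ℕ} :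
    c ∈ lineRow n L m a r ↔ c ∈ L ∨ ∃ j, 1 ≤ j ∧ j ≤ r ∧ c = lineGen n m a j := by
  induction r with
  | zero =>
    refine ⟨Or.inl, ?_⟩
    rintro (h | ⟨j, h₁, h₂, -⟩)
    · exact h
    · omega
  | succ r ih =>
    rw [lineRow, List.mem_cons, ih]
    constructor
    · rintro (h | h | ⟨j, h₁, h₂, h⟩)
      · exact Or.inr ⟨r + 1, by omega, le_rfl, h⟩
      · exact Or.inl h
      · exact Or.inr ⟨j, h₁, by omega, h⟩
    · rintro (h | ⟨j, h₁, h₂, h⟩)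
      · exact Or.inr (Or.inl h)
      · rcases eq_or_lt_of_le h₂ with rfl | h₂
        · exact Or.inl h
        · exact Or.inr (Or.inr ⟨j, h₁, by omega, h⟩)

theorem mem_lineList {m a : ℕ} {c : Fin n →₀ ℕ} :
    c ∈ lineList n m a ↔ c = Finsupp.single (Fin.ofNat n 0) m ∨
      ∃ b j, 1 ≤ b ∧ b ≤ a ∧ 1 ≤ j ∧ j ≤ n - 1 ∧ c = lineGen n m b j := by
  induction a with
  | zero =>
    rw [lineList, List.mem_singleton]
    refine ⟨Or.inl, ?_⟩
    rintro (h | ⟨b, j, h₁, h₂, -⟩)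
    · exact h
    · omega
  | succ a ih =>
    rw [lineList, mem_lineRow, ih]
    constructor
    · rintro ((h | ⟨b, j, h₁, h₂, h₃, h₄, h⟩) | ⟨j, h₃, h₄, h⟩)
      · exact Or.inl h
      · exact Or.inr ⟨b, j, h₁, by omega, h₃, h₄, h⟩
      · exact Or.inr ⟨a + 1, j, by omega, le_rfl, h₃, h₄, h⟩
    · rintro (h | ⟨b, j, h₁, h₂, h₃, h₄, h⟩)
      · exact Or.inl (Or.inl h)
      · rcases eq_or_lt_of_le h₂ with rfl | h₂
        · exact Or.inr ⟨j, h₃, h₄, h⟩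
        · exact Or.inl (Or.inr ⟨b, j, h₁, by omega, h₃, h₄, h⟩)

theorem degree_lineGen {m a j : ℕ} (ha : a ≤ m) : (lineGen n m a j).degree = m := by
  rw [lineGen, map_add, Finsupp.degree_single, Finsupp.degree_single, Nat.sub_add_cancel ha]

theorem lineGen_apply_zero {m a j : ℕ} (hj : 1 ≤ j) (hj' : j < n) :
    lineGen n m a j (Fin.ofNat n 0) = m - a := by
  rw [lineGen, Finsupp.add_apply, Finsupp.single_eq_same, Finsupp.single_eq_of_ne, add_zero]
  rw [Ne, ofNat_eq_ofNat_iff (by omega) hj']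
  omega

theorem lineGen_apply {m a j l : ℕ} (hl : 1 ≤ l) (hl' : l < n) (hj : j < n) :
    lineGen n m a j (Fin.ofNat n l) = if j = l then a else 0 := by
  rw [lineGen, Finsupp.add_apply, Finsupp.single_eq_of_ne, zero_add, Finsupp.single_apply]
  · simp only [ofNat_eq_ofNat_iff hj hl']
  · rw [Ne, ofNat_eq_ofNat_iff hl' (by omega)]
    omega

theorem lineGen_le_iff {m a j : ℕ} (hj : 1 ≤ j) (hj' : j < n) {u : Fin n →₀ ℕ} :
    lineGen n m a j ≤ u ↔ m - a ≤ u (Fin.ofNat n 0) ∧ a ≤ u (Fin.ofNat n j) := by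
  rw [lineGen, add_single_le_iff, Finsupp.single_le_iff, Finsupp.single_eq_of_ne, zero_add]
  rw [Ne, ofNat_eq_ofNat_iff hj' (by omega)]
  omega

theorem degree_of_mem_lineRow {m a r : ℕ} (ha : a + 1 ≤ m) {c : Fin n →₀ ℕ}
    (hc : c ∈ lineRow n (lineList n m a) m (a + 1) r) : c.degree = m := by
  rcases mem_lineRow.1 hc with hc | ⟨j, -, -, rfl⟩
  · rcases mem_lineList.1 hc with rfl | ⟨b, j, -, hb, -, -, rfl⟩
    · exact Finsupp.degree_single _ _
    · exact degree_lineGen (by omega)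
  · exact degree_lineGen ha

/-- The exponent of `y_{r+1}` is `a + 1` in the new generator and at most `a` in all the earlier
ones. -/
theorem lineGen_notMem_lineRow {m a r : ℕ} (hr : r + 1 < n) :
    lineGen n m (a + 1) (r + 1) ∉ lineRow n (lineList n m a) m (a + 1) r := by
  intro hc
  have key := lineGen_apply (m := m) (a := a + 1) (Nat.le_add_left 1 r) hr hr
  rw [if_pos rfl] at key
  rcases mem_lineRow.1 hc with hc | ⟨j, hj, hj', hc⟩
  · rcases mem_lineList.1 hc with hc | ⟨b, j, -, hb, -, hj, hc⟩
    · rw [hc, Finsupp.single_eq_of_ne] at key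
      · omega
      · rw [Ne, ofNat_eq_ofNat_iff hr (by omega)]
        omega
    · rw [hc, lineGen_apply (by omega) hr (by omega)] at key
      split_ifs at key; omega
  · rw [hc, lineGen_apply (by omega) hr (by omega)] at key
    split_ifs at key; omega

theorem eq_of_le_of_degree_eq {ι : Type*} {a b : ι →₀ ℕ} (h : a ≤ b) (h' : a.degree = b.degree) :
    a = b := by
  obtain ⟨c, rfl⟩ := exists_add_of_le h
  rw [map_add] at h'
  have : c.degree = 0 := by omega
  rw [(Finsupp.degree_eq_zero_iff c).1 this, add_zero]

/-- Earlier rows have a larger exponent of `y_0`, so together they contribute the factor `y_0`. An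
earlier generator `y_0^{m-a-1} y_j^{a+1}` of the same row contributes `y_j^{a+1}`. -/
theorem lineRow_inf_lineGen {m a r : ℕ} (ha : a + 1 ≤ m) (hr : r + 1 < n) (u : Fin n →₀ ℕ) :
    ((∃ c ∈ lineRow n (lineList n m a) m (a + 1) r, c ≤ u) ∧ lineGen n m (a + 1) (r + 1) ≤ u) ↔
      ∃ c ∈ powersList (lineGen n m (a + 1) (r + 1)) (a + 1) r, c ≤ u := by
  rw [exists_mem_powersList_le, and_comm, lineGen_apply_zero (by omega) hr]
  refine and_congr_right fun hu => ?_
  have hu' := hu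
  rw [lineGen_le_iff (by omega) hr] at hu'
  have key : ∀ j, 1 ≤ j → j ≤ r → lineGen n m (a + 1) (r + 1) (Fin.ofNat n j) = 0 :=
    fun j hj hj' => by
      rw [lineGen_apply hj (by omega) hr, if_neg (by omega)]
  constructor
  · rintro ⟨c, hc, hcu⟩
    rcases mem_lineRow.1 hc with hc | ⟨j, hj, hj', rfl⟩
    · left
      rcases mem_lineList.1 hc with rfl | ⟨b, j, hb, hb', hj, hj', rfl⟩
      · rw [Finsupp.single_le_iff] at hcu
        omega
      · rw [lineGen_le_iff hj (by omega)] at hcu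
        omega
    · right
      rw [lineGen_le_iff hj (by omega)] at hcu
      exact ⟨j, hj, hj', by rw [key j hj hj', zero_add]; exact hcu.2⟩
  · rintro (h | ⟨j, hj, hj', h⟩)
    -- A multiple of `y_0 g` is divisible by the generator of the preceding row in the same variable
    -- `y_{r+1}`; before the first row, `y_0^m` plays that role.
    · rcases a with _ | a
      · refine ⟨_, mem_lineRow.2 (Or.inl (mem_lineList.2 (Or.inl rfl))), ?_⟩
        rw [Finsupp.single_le_iff]
        omega
      · refine ⟨_, mem_lineRow.2 (Or.inl (mem_lineList.2 (Or.inr ⟨a + 1, r + 1, by omega, le_rfl,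
          by omega, by omega, rfl⟩))), ?_⟩
        rw [lineGen_le_iff (by omega) hr]
        omega
    · refine ⟨_, mem_lineRow.2 (Or.inr ⟨j, hj, hj', rfl⟩), ?_⟩
      rw [key j hj hj', zero_add] at h
      rw [lineGen_le_iff hj (by omega)]
      exact ⟨hu'.1, h⟩

/-- The bound `m + i(a+1)` persists through the row and stays just below `m + 1 + i(a+1)`, where
each resolution of an intersection begins. The second bound controls `e - i`, hence the regularity.
-/
theorem exists_isConeResolution_lineRow {m a : ℕ} (ha : a + 1 ≤ m)
    (H : ∃ (F : FreeComplex k n)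
      (ε : F.obj 0 →ₗ[MvPolynomial (Fin n) k] MvPolynomial (Fin n) k),
      IsConeResolution (lineList n m a) F ε ∧ F.rank 0 = 1 + a * (n - 1) ∧
      (∀ i, F.rank (i + 1) = a * n.choose (i + 2)) ∧
      (∀ i e, F.HasDeg i e → e ≤ m + i * a ∧ e ≤ m + (n - 2) * (m - 1) + i)) {r : ℕ}
    (hr : r < n) :
    ∃ (F : FreeComplex k n)
      (ε : F.obj 0 →ₗ[MvPolynomial (Fin n) k] MvPolynomial (Fin n) k),
      IsConeResolution (lineRow n (lineList n m a) m (a + 1) r) F ε ∧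
      F.rank 0 = 1 + a * (n - 1) + r ∧
      (∀ i, F.rank (i + 1) = a * n.choose (i + 2) + (r + 1).choose (i + 2)) ∧
      (∀ i e, F.HasDeg i e → e ≤ m + i * (a + 1) ∧ e ≤ m + (n - 2) * (m - 1) + i) ∧
      (1 ≤ r → F.HasDeg r (m + 1 + (r - 1) * (a + 1))) := by
  induction r with
  | zero =>
    obtain ⟨F, ε, h₀, h₁, h₂, h₃⟩ := H
    refine ⟨F, ε, h₀, h₁, fun i => ?_, fun i e he => ?_, fun h => by omega⟩
    · rw [h₂, Nat.choose_eq_zero_of_lt (by omega : 0 + 1 < i + 2), add_zero]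
    · have := h₃ i e he
      rw [mul_add]
      omega
  | succ r ih =>
    obtain ⟨F, ε, h₀, h₁, h₂, h₃, -⟩ := ih (by omega)
    obtain ⟨F', ε', h₀', h₁', h₂', h₃'⟩ := exists_isConeResolution_powersList (k := k)
      (Nat.le_add_left 1 a) (by omega : r < n) (lineGen n m (a + 1) (r + 1))
    rw [degree_lineGen ha] at h₂' h₃'
    -- All generators have degree `m`, so distinct ones cannot divide each other.
    have hg : ∀ c ∈ lineRow n (lineList n m a) m (a + 1) r,
        ¬ lineGen n m (a + 1) (r + 1) ≤ c ∧ ¬ c ≤ lineGen n m (a + 1) (r + 1) := by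
      intro c hc
      have hd := degree_of_mem_lineRow ha hc
      have hd' := degree_lineGen (n := n) (j := r + 1) ha
      constructor
      · intro hle
        rw [← eq_of_le_of_degree_eq hle (hd'.trans hd.symm)] at hc
        exact lineGen_notMem_lineRow hr hc
      · intro hle
        rw [eq_of_le_of_degree_eq hle (hd.trans hd'.symm)] at hc
        exact lineGen_notMem_lineRow hr hc
    have hdeg : ∀ i e e', F.HasDeg i e → F'.HasDeg i e' → e < e' := by
      intro i e e' he he'
      have h₄ := (h₃ _ _ he).1
      have h₅ := (h₂' _ _ he').1
      omega
    have hdeg' : ∀ e', F'.HasDeg 0 e' → (lineGen n m (a + 1) (r + 1)).degree < e' := by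
      intro e' he'
      have h₅ := (h₂' _ _ he').1
      rw [degree_lineGen ha]
      omega
    obtain ⟨G, η, g₀, g₁, g₂, g₃, g₄⟩ := h₀.exists_cons h₀' hg (lineRow_inf_lineGen ha hr)
      hdeg hdeg'
    refine ⟨G, η, g₀, ?_, fun i => ?_, ?_, fun _ => ?_⟩
    · rw [g₁, h₁, add_assoc]
    · rw [g₂, h₁', h₂, Nat.choose_succ_succ' (r + 1)]
      ring
    · rintro (_ | i) e he
      · rcases (g₃ e).1 he with he | rfl
        · exact h₃ _ _ he
        · rw [degree_lineGen ha]
          omega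
      · rcases (g₄ i e).1 he with he | he
        · have h₄ := h₂' _ _ he
          -- The new elements satisfy `e ≤ m + ra + (i + 1)`, and here `r ≤ n - 2` and `a ≤ m - 1`.
          have h₅ : r * a ≤ (n - 2) * (m - 1) := Nat.mul_le_mul (by omega) (by omega)
          simp only [mul_add, mul_one, add_mul, one_mul] at h₄ ⊢
          omega
        · exact h₃ _ _ he
    · exact (g₄ r _).2 (Or.inl h₃')

/-- Each complete row adds `C(n, i+2)` to the rank in homological degree `i + 1`. The recorded top
degree comes from the last generator of the last row, which exists only for `a ≥ 1` and `n ≥ 2`. -/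
theorem exists_isConeResolution_lineList {m a : ℕ} (ha : a ≤ m) :
    ∃ (F : FreeComplex k n)
      (ε : F.obj 0 →ₗ[MvPolynomial (Fin n) k] MvPolynomial (Fin n) k),
      IsConeResolution (lineList n m a) F ε ∧ F.rank 0 = 1 + a * (n - 1) ∧
      (∀ i, F.rank (i + 1) = a * n.choose (i + 2)) ∧
      (∀ i e, F.HasDeg i e → e ≤ m + i * a ∧ e ≤ m + (n - 2) * (m - 1) + i) ∧
      (1 ≤ a → 2 ≤ n → F.HasDeg (n - 1) (m + 1 + (n - 2) * a)) := by
  induction a with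
  | zero =>
    obtain ⟨F, ε, h₀, h₁, h₂, h₃, h₄⟩ := exists_isConeResolution_singleton (k := k)
      (Finsupp.single (Fin.ofNat n 0) m)
    rw [Finsupp.degree_single] at h₃
    refine ⟨F, ε, h₀, by simpa using h₁, by simpa using h₂, ?_, by omega⟩
    rintro (_ | i) e he
    · rw [h₃] at he
      omega
    · exact (h₄ _ _ he).elim
  | succ a ih =>
    obtain ⟨F, ε, h₀, h₁, h₂, h₃, -⟩ := ih (by omega)
    have hn := NeZero.pos n
    obtain ⟨G, η, g₀, g₁, g₂, g₃, g₄⟩ := exists_isConeResolution_lineRow (k := k) ha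
      ⟨F, ε, h₀, h₁, h₂, h₃⟩ (by omega : n - 1 < n)
    refine ⟨G, η, g₀, ?_, fun i => ?_, g₃, fun _ h => g₄ (by omega)⟩
    · rw [g₁]
      ring
    · rw [g₂, Nat.sub_add_cancel hn]
      ring

theorem monomialSpan_lineList {m : ℕ} (hm : 1 ≤ m) :
    monomialSpan k (lineList n m m) = linesIdeal k n m := by
  have h0 : Fin.ofNat n 0 = 0 := rfl
  have hgen : ∀ a j : ℕ, mono k (lineGen n m a j) = X 0 ^ (m - a) * X (Fin.ofNat n j) ^ a :=
    fun a j => by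
      rw [mono, lineGen, X_pow_eq_monomial, X_pow_eq_monomial, monomial_mul, mul_one, h0]
  have hj : ∀ j : Fin n, Fin.ofNat n j = j := fun j => by simp
  rw [monomialSpan, linesIdeal]
  congr 1
  ext p
  constructor
  · rintro ⟨c, hc, rfl⟩
    rcases mem_lineList.1 hc with rfl | ⟨b, j, hb, hb', hj, hj', rfl⟩
    · exact Or.inl ⟨0, (X_pow_eq_monomial).symm⟩
    · rw [hgen]
      rcases eq_or_lt_of_le hb' with rfl | hb'
      · exact Or.inl ⟨Fin.ofNat n j, by simp⟩
      · refine Or.inr ⟨Fin.ofNat n j, b, ?_, hb, hb', rfl⟩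
        rw [← h0, Ne, ofNat_eq_ofNat_iff (by omega) (by omega)]
        omega
  · rintro (⟨j, rfl⟩ | ⟨j, a, hj0, ha, ha', rfl⟩)
    · by_cases hj0 : j = 0
      · exact ⟨_, mem_lineList.2 (Or.inl rfl), by rw [hj0, X_pow_eq_monomial]; rfl⟩
      · have := Fin.val_ne_zero_iff.2 hj0
        refine ⟨lineGen n m m j, mem_lineList.2 (Or.inr ⟨m, j, hm, le_rfl, by omega, by omega,
          rfl⟩), ?_⟩
        rw [hgen, hj]
        simp
    · have := Fin.val_ne_zero_iff.2 hj0
      refine ⟨lineGen n m a j, mem_lineList.2 (Or.inr ⟨a, j, ha, ha'.le, by omega, by omega,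
        rfl⟩), ?_⟩
      rw [hgen, hj]

end LinesIdeal
-- Projective dimension from a finite minimal resolution.
section ProjectiveDimension

variable {k : Type u} [Field k] {n : ℕ}

open FreeComplex CategoryTheory

/-- The complex `⋯ → F_2 → F_1`. -/
noncomputable def FreeComplex.shift (F : FreeComplex k n) : FreeComplex k n where
  ι i := F.ι (i + 1)
  fin i := F.fin (i + 1)
  deg i := F.deg (i + 1)
  d i := F.d (i + 1)
  d_comp_d i := F.d_comp_d (i + 1)
  d_homog i := F.d_homog (i + 1)

variable {N : Type u} [AddCommGroup N] [Module (MvPolynomial (Fin n) k) N]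

/-- The map `F_1 → ker η` induced by the differential of an exact complex. -/
noncomputable def FreeComplex.shiftAug (F : FreeComplex k n)
    (η : F.obj 0 →ₗ[MvPolynomial (Fin n) k] N)
    (hη : LinearMap.ker η = LinearMap.range (F.d 0)) :
    F.shift.obj 0 →ₗ[MvPolynomial (Fin n) k] LinearMap.ker η :=
  (F.d 0).codRestrict (LinearMap.ker η) fun x => hη ▸ LinearMap.mem_range_self _ x

theorem FreeComplex.shiftAug_surjective (F : FreeComplex k n)
    (η : F.obj 0 →ₗ[MvPolynomial (Fin n) k] N)
    (hη : LinearMap.ker η = LinearMap.range (F.d 0)) :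
    Function.Surjective (F.shiftAug η hη) := by
  rintro ⟨x, hx⟩
  obtain ⟨y, rfl⟩ := hη ▸ hx
  exact ⟨y, rfl⟩

theorem FreeComplex.ker_shiftAug (F : FreeComplex k n)
    (η : F.obj 0 →ₗ[MvPolynomial (Fin n) k] N)
    (hη : LinearMap.ker η = LinearMap.range (F.d 0)) :
    LinearMap.ker (F.shiftAug η hη) = LinearMap.ker (F.d 0) :=
  LinearMap.ker_codRestrict _ _ _

theorem projective_obj (F : FreeComplex k n) (i : ℕ) :
    Projective (ModuleCat.of (MvPolynomial (Fin n) k) (F.obj i)) :=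
  (IsProjective.iff_projective (F.obj i)).1 inferInstance

/-- Dimension shifting: the truncated complex resolves the syzygy module `ker η`, and the middle
term `F_0` is projective. -/
theorem hasProjectiveDimensionLT_of_isEmpty (m : ℕ) (F : FreeComplex k n)
    (η : F.obj 0 →ₗ[MvPolynomial (Fin n) k] N) (hs : Function.Surjective η)
    (hη : LinearMap.ker η = LinearMap.range (F.d 0))
    (hF : ∀ i, LinearMap.ker (F.d i) = LinearMap.range (F.d (i + 1))) (hm : IsEmpty (F.ι m)) :
    HasProjectiveDimensionLT (ModuleCat.of (MvPolynomial (Fin n) k) N) m := by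
  induction m generalizing F N with
  | zero =>
    have := hs.subsingleton
    exact (ModuleCat.isZero_of_subsingleton _).hasProjectiveDimensionLT_zero
  | succ m ih =>
    have h := LinearMap.shortExact_shortComplexKer hs
    have := projective_obj F 0
    exact h.hasProjectiveDimensionLT_X₃ m
      (ih F.shift (F.shiftAug η hη) (F.shiftAug_surjective η hη) ((F.ker_shiftAug η hη).trans (hF 0))
        (fun i => hF (i + 1)) hm)
      (inferInstanceAs (HasProjectiveDimensionLT
        (ModuleCat.of (MvPolynomial (Fin n) k) (F.obj 0)) (m + 1)))

theorem single_one_notMem_maxSMul {ι : Type} (b : ι) :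
    Finsupp.single b 1 ∉ maxSMul k n (ι →₀ MvPolynomial (Fin n) k) := by
  rw [mem_maxSMul_iff]
  intro h
  simpa using h b

/-- Shifting reduces to `F_2 = 0`, where `F_1 ≅ ker η`. If `N` were projective, `F_0` would retract
onto `ker η`; as `d F_1 ⊆ 𝔪 F_0`, this would put a basis element of `F_1` into `𝔪 F_1`. -/
theorem not_hasProjectiveDimensionLT (m : ℕ) (F : FreeComplex k n)
    (η : F.obj 0 →ₗ[MvPolynomial (Fin n) k] N) (hs : Function.Surjective η)
    (hη : LinearMap.ker η = LinearMap.range (F.d 0))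
    (hF : ∀ i, LinearMap.ker (F.d i) = LinearMap.range (F.d (i + 1))) (hmin : F.IsMinimal)
    (b : F.ι m) (hm : IsEmpty (F.ι (m + 1))) :
    ¬ HasProjectiveDimensionLT (ModuleCat.of (MvPolynomial (Fin n) k) N) m := by
  induction m generalizing F N with
  | zero =>
    rw [hasProjectiveDimensionLT_zero_iff_isZero, ModuleCat.isZero_iff_subsingleton]
    intro (_ : Subsingleton N)
    have h : Finsupp.single b 1 ∈ LinearMap.ker η := Subsingleton.elim _ _
    rw [hη] at h
    exact single_one_notMem_maxSMul b (hmin 0 h)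
  | succ m ih =>
    intro H
    have h := LinearMap.shortExact_shortComplexKer hs
    rcases m with _ | m
    · have hN : Module.Projective (MvPolynomial (Fin n) k) N :=
        (IsProjective.iff_projective N).2 (projective_iff_hasProjectiveDimensionLT_one.2 H)
      obtain ⟨σ, hσ⟩ := Module.projective_lifting_property η LinearMap.id hs
      have hσ' : ∀ x, η (σ x) = x := fun x => LinearMap.congr_fun hσ x
      -- The retraction `id - σ η` of the inclusion `ker η ⊆ F_0`.
      let s : F.obj 0 →ₗ[MvPolynomial (Fin n) k] LinearMap.ker η :=
        (LinearMap.id - σ ∘ₗ η).codRestrict (LinearMap.ker η) fun x => by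
          simp [hσ']
      have hd : ∀ x : F.obj 1, F.d 0 x = 0 → x = 0 := by
        intro x hx
        rw [← LinearMap.mem_ker, hF 0] at hx
        obtain ⟨y, rfl⟩ := hx
        have : Subsingleton (F.obj 2) := inferInstance
        rw [Subsingleton.elim y 0, map_zero]
      have hinj : Function.Injective (F.shiftAug η hη) := fun (x y : F.obj 1) hxy =>
        sub_eq_zero.1 (hd (x - y) ((map_sub (F.d 0) x y).trans
          (sub_eq_zero.2 (congrArg Subtype.val hxy))))
      let e := LinearEquiv.ofBijective _ ⟨hinj, F.shiftAug_surjective η hη⟩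
      have h₁ : s (F.d 0 (Finsupp.single b 1)) ∈ maxSMul k n (LinearMap.ker η) :=
        map_mem_maxSMul (M := F.obj 0) (N := LinearMap.ker η) s
          (hmin 0 (LinearMap.mem_range_self (F.d 0) _))
      have h₂ : s (F.d 0 (Finsupp.single b 1)) = e (Finsupp.single b 1) := by
        have hz : η (F.d 0 (Finsupp.single b 1)) = 0 := by
          rw [← LinearMap.mem_ker, hη]
          exact ⟨_, rfl⟩
        refine Subtype.ext ?_
        show F.d 0 (Finsupp.single b 1) - σ (η (F.d 0 (Finsupp.single b 1))) =
          F.d 0 (Finsupp.single b 1)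
        rw [hz, map_zero, sub_zero]
      have h₃ := map_mem_maxSMul e.symm.toLinearMap h₁
      rw [h₂, LinearEquiv.coe_coe, LinearEquiv.symm_apply_apply] at h₃
      exact single_one_notMem_maxSMul (k := k) (n := n) b h₃
    · have h' : HasProjectiveDimensionLT
          (ModuleCat.of (MvPolynomial (Fin n) k) (LinearMap.ker η)) (m + 1) :=
        (h.hasProjectiveDimensionLT_X₃_iff m (projective_obj F 0)).1 H
      have h'' := ih (N := LinearMap.ker η) F.shift (F.shiftAug η hη)
        (F.shiftAug_surjective η hη) ((F.ker_shiftAug η hη).trans (hF 0))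
        (fun i => hF (i + 1)) (fun i => hmin (i + 1)) b hm
      exact h'' h'

end ProjectiveDimension

/-! ### Gradings and minimal resolutions of an ideal and of its quotient. -/

section Gradings

variable {k : Type u} [Field k] {n : ℕ}

open FreeComplex

theorem isGrading_idealGrading {I : Ideal (MvPolynomial (Fin n) k)}
    (hI : ∀ e, ∀ p ∈ I, homogeneousComponent e p ∈ I) : IsGrading (n := n) (idealGrading I) where
  smul_mem hp hx := hp.mul hx
  exists_proj e := by
    refine ⟨(((homogeneousComponent e).toAddMonoidHom.comp
      (Submodule.subtype I).toAddMonoidHom).codRestrict I fun p => hI e p p.2),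
      fun x hx => Subtype.ext (homogeneousComponent_eq_self hx), fun e' he' x hx => Subtype.ext ?_⟩
    exact (homogeneousComponent_of_mem hx).trans (if_neg he'.symm)

theorem isGrading_quotientGrading {I : Ideal (MvPolynomial (Fin n) k)}
    (hI : ∀ e, ∀ p ∈ I, homogeneousComponent e p ∈ I) :
    IsGrading (n := n) (quotientGrading I) where
  smul_mem {d e p x} hp hx := by
    obtain ⟨q, hq, rfl⟩ := hx
    exact ⟨p * q, hp.mul hq, map_mul (Ideal.Quotient.mk I) p q⟩
  exists_proj e := by
    let f : MvPolynomial (Fin n) k →+ MvPolynomial (Fin n) k ⧸ I :=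
      (Ideal.Quotient.mk I).toAddMonoidHom.comp (homogeneousComponent e).toAddMonoidHom
    -- The homogeneous component descends to the quotient because `I` contains the components of its
    -- elements.
    have hf : (Ideal.Quotient.mk I).toAddMonoidHom.ker ≤ f.ker := fun p hp =>
      Ideal.Quotient.eq_zero_iff_mem.2 (hI e p (Ideal.Quotient.eq_zero_iff_mem.1 hp))
    have key : ∀ p, (Ideal.Quotient.mk I).toAddMonoidHom.liftOfSurjective
        Ideal.Quotient.mk_surjective ⟨f, hf⟩ (Ideal.Quotient.mk I p) =
        Ideal.Quotient.mk I (homogeneousComponent e p) :=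
      fun p => AddMonoidHom.liftOfRightInverse_comp_apply _ _ _ ⟨f, hf⟩ p
    refine ⟨(Ideal.Quotient.mk I).toAddMonoidHom.liftOfSurjective
      Ideal.Quotient.mk_surjective ⟨f, hf⟩, ?_, ?_⟩
    · rintro _ ⟨q, hq, rfl⟩
      exact (key q).trans (congrArg _ (homogeneousComponent_eq_self hq))
    · rintro e' he' _ ⟨q, hq, rfl⟩
      refine (key q).trans ?_
      rw [homogeneousComponent_of_mem hq, if_neg he'.symm, map_zero]

theorem homogeneousComponent_mem_monomialSpan (L : List (Fin n →₀ ℕ)) (e : ℕ)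
    (p : MvPolynomial (Fin n) k) (hp : p ∈ monomialSpan k L) :
    homogeneousComponent e p ∈ monomialSpan k L := by
  rw [mem_monomialSpan_iff] at *
  intro w hw
  rw [support_homogeneousComponent, Finset.mem_filter] at hw
  exact hp w hw.1

variable {I : Ideal (MvPolynomial (Fin n) k)} {F : FreeComplex k n}
  {ε : F.obj 0 →ₗ[MvPolynomial (Fin n) k] MvPolynomial (Fin n) k}

/-- The minimal graded free resolution of an ideal. -/
noncomputable def ResolvesIdeal.toMinimalResolution (h : ResolvesIdeal I F ε) :
    MinimalResolution (n := n) (idealGrading I) where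
  toFreeComplex := F
  aug := ε.codRestrict I fun x => h.range_aug ▸ LinearMap.mem_range_self _ x
  aug_homog b := h.aug_homog b
  aug_surjective := by
    rintro ⟨p, hp⟩
    obtain ⟨x, rfl⟩ := h.range_aug ▸ hp
    exact ⟨x, rfl⟩
  exact_zero := (LinearMap.ker_codRestrict _ _ _).trans h.exact_zero
  exact_succ := h.exact_succ
  minimal := h.minimal

theorem ResolvesIdeal.aug_d (h : ResolvesIdeal I F ε) (x : F.obj 1) : ε (F.d 0 x) = 0 := by
  rw [← LinearMap.mem_ker, h.exact_zero]
  exact ⟨x, rfl⟩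

theorem ResolvesIdeal.isHomog_single_aug (h : ResolvesIdeal I F ε) (b : F.ι 0) :
    IsHomog (fun _ : Unit => 0) (F.deg 0 b) (Finsupp.single () (ε (Finsupp.single b 1))) := by
  intro u w hw
  have hw' : w ∈ (ε (Finsupp.single b 1)).support := by simpa using hw
  rw [(h.aug_homog b).degree_eq_sum_deg_support hw']
  rfl

/-- The quotient map `S → S / I`, with `S` viewed as a free module on one generator. -/
noncomputable def quotientAug (I : Ideal (MvPolynomial (Fin n) k)) :
    (Unit →₀ MvPolynomial (Fin n) k) →ₗ[MvPolynomial (Fin n) k] MvPolynomial (Fin n) k ⧸ I :=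
  Submodule.mkQ I ∘ₗ Finsupp.lapply ()

theorem quotientAug_single (p : MvPolynomial (Fin n) k) :
    quotientAug I (Finsupp.single () p) = Ideal.Quotient.mk I p := by
  rw [quotientAug, LinearMap.comp_apply, Finsupp.lapply_apply, Finsupp.single_eq_same]
  rfl

theorem ResolvesIdeal.ker_quotientAug (h : ResolvesIdeal I F ε) :
    LinearMap.ker (quotientAug I) = LinearMap.range (Finsupp.lsingle () ∘ₗ ε) := by
  ext z
  obtain ⟨p, rfl⟩ : ∃ p, z = Finsupp.single () p := ⟨_, Finsupp.unique_single z⟩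
  rw [LinearMap.mem_ker, quotientAug_single, Ideal.Quotient.eq_zero_iff_mem, ← h.range_aug]
  constructor
  · rintro ⟨x, rfl⟩
    exact ⟨x, rfl⟩
  · rintro ⟨x, hx⟩
    exact ⟨x, Finsupp.single_injective () hx⟩

theorem ResolvesIdeal.range_lsingle_le (h : ResolvesIdeal I F ε)
    (hI : ∀ p ∈ I, constantCoeff p = 0) :
    LinearMap.range (Finsupp.lsingle () ∘ₗ ε) ≤ maxSMul k n (Unit →₀ MvPolynomial (Fin n) k) := by
  rintro _ ⟨x, rfl⟩
  refine (mem_maxSMul_iff _).2 fun u => ?_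
  have : ε x ∈ I := h.range_aug ▸ LinearMap.mem_range_self _ x
  rw [LinearMap.comp_apply, Finsupp.lsingle_apply, Finsupp.single_eq_same]
  exact hI _ this

/-- The complex `⋯ → F_1 → F_0 → S`. -/
noncomputable def ResolvesIdeal.extend (h : ResolvesIdeal I F ε) : FreeComplex k n where
  ι
    | 0 => Unit
    | i + 1 => F.ι i
  fin
    | 0 => inferInstanceAs (Finite Unit)
    | i + 1 => F.fin i
  deg
    | 0 => fun _ => 0
    | i + 1 => F.deg i
  d
    | 0 => Finsupp.lsingle () ∘ₗ ε
    | i + 1 => F.d i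
  d_comp_d
    | 0 => LinearMap.ext fun x => by
        show Finsupp.single () (ε (F.d 0 x)) = 0
        rw [h.aug_d, Finsupp.single_zero]
    | i + 1 => F.d_comp_d i
  d_homog
    | 0 => fun (b : F.ι 0) => h.isHomog_single_aug b
    | i + 1 => F.d_homog i

/-- The minimal graded free resolution of the quotient by a proper ideal. -/
noncomputable def ResolvesIdeal.toMinimalResolutionQuotient (h : ResolvesIdeal I F ε)
    (hI : ∀ p ∈ I, constantCoeff p = 0) :
    MinimalResolution (n := n) (quotientGrading I) where
  toFreeComplex := h.extend
  aug := quotientAug I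
  aug_homog _ := ⟨1, isHomogeneous_one _ _, (quotientAug_single 1).symm⟩
  aug_surjective := by
    intro q
    obtain ⟨p, rfl⟩ := Ideal.Quotient.mk_surjective q
    exact ⟨Finsupp.single () p, quotientAug_single p⟩
  exact_zero := h.ker_quotientAug
  exact_succ
    | 0 => (LinearMap.ker_comp_of_ker_eq_bot _
        (LinearMap.ker_eq_bot.2 (Finsupp.single_injective _))).trans h.exact_zero
    | i + 1 => h.exact_succ i
  minimal
    | 0 => h.range_lsingle_le hI
    | i + 1 => h.minimal i

end Gradings
-- Binomial identities for the Betti numbers.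
section Numerics

theorem sum_range_choose_succ (n i : ℕ) :
    ∑ s ∈ Finset.range n, (s + 1).choose (i + 1) = (n + 1).choose (i + 2) := by
  induction n with
  | zero => rw [Finset.sum_range_zero, Nat.choose_eq_zero_of_lt (by omega)]
  | succ n ih => rw [Finset.sum_range_succ, ih, Nat.choose_succ_succ' (n + 1), add_comm]

theorem sum_Icc_choose (n i : ℕ) :
    ∑ j ∈ Finset.Icc 2 (n + 1), (1 + (n + 1) - j).choose (i + 1) = (n + 1).choose (i + 2) := by
  rw [← sum_range_choose_succ, ← Finset.sum_range_reflect, ← Finset.Ico_add_one_right_eq_Icc,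
    Finset.sum_Ico_eq_sum_range]
  refine Finset.sum_congr (by simp) fun j hj => ?_
  rw [Finset.mem_range] at hj
  congr 1
  omega

/-- The sum is `(m-1) C(n, i+2)` by the hockey-stick identity, and the outer binomials add up to one
more `C(n, i+2)` by Pascal's rule. -/
theorem mul_choose_eq {n m i : ℕ} (hn : 1 ≤ n) (hm : 1 ≤ m) :
    m * n.choose (i + 2) = (n - 1).choose (i + 1) +
      ∑ j ∈ Finset.Icc 2 n, (m - 1) * (1 + n - j).choose (i + 1) + (n - 1).choose (i + 2) := by
  obtain ⟨n, rfl⟩ := Nat.exists_eq_add_of_le' hn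
  obtain ⟨m, rfl⟩ := Nat.exists_eq_add_of_le' hm
  rw [← Finset.mul_sum, sum_Icc_choose, Nat.add_sub_cancel, Nat.add_sub_cancel,
    Nat.choose_succ_succ' n (i + 1)]
  ring

end Numerics

/-! ### Assembly of the four assertions. -/

section Main

variable {k : Type u} [Field k] {n : ℕ}

theorem rank_eq_zero_iff_isEmpty (F : FreeComplex k n) (i : ℕ) :
    F.rank i = 0 ↔ IsEmpty (F.ι i) := by
  have := F.fin i
  rw [FreeComplex.rank, Finite.card_eq_zero_iff]

theorem constantCoeff_eq_zero_of_mem_linesIdeal [NeZero n] {m : ℕ} (hm : 1 ≤ m)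
    {p : MvPolynomial (Fin n) k} (hp : p ∈ linesIdeal k n m) : constantCoeff p = 0 := by
  have h : linesIdeal k n m ≤ RingHom.ker (constantCoeff (R := k) (σ := Fin n)) := by
    refine Ideal.span_le.2 ?_
    rintro p (⟨j, rfl⟩ | ⟨j, a, -, ha, -, rfl⟩)
    · simp [RingHom.mem_ker, show m ≠ 0 by omega]
    · simp [RingHom.mem_ker, show a ≠ 0 by omega]
  exact h hp

end Main
end GradedRes

open GradedRes

theorem mainTheorem4 {k : Type u} [Field k] (n m : ℕ) [NeZero n] (hm : 1 ≤ m) :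
    -- the Betti numbers
    GradedRes.HasBettiNumber (n := n) (GradedRes.idealGrading (GradedRes.linesIdeal k n m))
      0 (n + (n - 1) * (m - 1)) ∧
    (∀ i : ℕ, 1 ≤ i → i ≤ n - 1 →
      GradedRes.HasBettiNumber (n := n) (GradedRes.idealGrading (GradedRes.linesIdeal k n m)) i
        ((n - 1).choose i + ∑ j ∈ Finset.Icc 2 n, (m - 1) * (1 + n - j).choose i
          + (n - 1).choose (i + 1))) ∧
    -- the projective dimension
    CategoryTheory.projectiveDimension
      (ModuleCat.of (MvPolynomial (Fin n) k) (GradedRes.linesIdeal k n m)) = (n - 1 : ℕ) ∧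
    -- the regularity
    (2 ≤ n →
      GradedRes.HasRegularity (n := n) (GradedRes.quotientGrading (GradedRes.linesIdeal k n m))
        ((n - 1) * (m - 1) : ℕ) ∧
      GradedRes.HasRegularity (n := n) (GradedRes.idealGrading (GradedRes.linesIdeal k n m))
        ((n - 1) * (m - 1) + 1 : ℕ)) ∧
    -- the minimal free resolution as an iterated mapping cone
    (∃ (L : List (Fin n →₀ ℕ))
      (F : GradedRes.MinimalResolution (n := n)
        (GradedRes.idealGrading (GradedRes.linesIdeal k n m))),
      GradedRes.IsMinimalGenerators L (GradedRes.linesIdeal k n m) ∧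
      GradedRes.IsIteratedMappingCone L F.toFreeComplex
        ((GradedRes.linesIdeal k n m).subtype ∘ₗ F.aug)) := by
  have hn : 1 ≤ n := NeZero.pos n
  obtain ⟨F, ε, h, h₀, h₁, h₂, h₃⟩ := exists_isConeResolution_lineList (k := k) (n := n) (le_refl m)
  have hJ := monomialSpan_lineList (k := k) (n := n) hm
  have hR : ResolvesIdeal (linesIdeal k n m) F ε := hJ ▸ h.resolves
  have hhom : ∀ e, ∀ p ∈ linesIdeal k n m, homogeneousComponent e p ∈ linesIdeal k n m :=
    hJ ▸ homogeneousComponent_mem_monomialSpan _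
  have hgr := isGrading_idealGrading hhom
  have hgr' := isGrading_quotientGrading hhom
  have hcc : ∀ p ∈ linesIdeal k n m, constantCoeff p = 0 :=
    fun p hp => constantCoeff_eq_zero_of_mem_linesIdeal hm hp
  have hempty : IsEmpty (F.ι n) := by
    obtain ⟨n, rfl⟩ := Nat.exists_eq_add_of_le' hn
    rw [← rank_eq_zero_iff_isEmpty, h₁, Nat.choose_eq_zero_of_lt (by omega), mul_zero]
  -- The rank in homological degree `n - 1` is `m C(n, n) = m` for `n ≥ 2`, and it is `1` for `n =
  -- 1`.
  have hne : Nonempty (F.ι (n - 1)) := by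
    rw [← not_isEmpty_iff, ← rank_eq_zero_iff_isEmpty]
    rcases eq_or_lt_of_le hn with rfl | hn'
    · rw [h₀]
      omega
    · obtain ⟨n, rfl⟩ := Nat.exists_eq_add_of_le' hn'
      rw [show n + 2 - 1 = n + 1 by omega, h₁, Nat.choose_self]
      omega
  refine ⟨?_, ?_, ?_, fun hn₂ => ?_, ?_⟩
  · refine hR.toMinimalResolution.hasBettiNumber hgr (h₀.trans ?_)
    obtain ⟨n, rfl⟩ := Nat.exists_eq_add_of_le' hn
    obtain ⟨m, rfl⟩ := Nat.exists_eq_add_of_le' hm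
    simp only [Nat.add_sub_cancel]
    ring
  · intro i hi hin
    obtain ⟨i, rfl⟩ := Nat.exists_eq_add_of_le' hi
    exact hR.toMinimalResolution.hasBettiNumber hgr ((h₁ i).trans (mul_choose_eq hn hm))
  · have hs := hR.toMinimalResolution.aug_surjective
    have hz := hR.toMinimalResolution.exact_zero
    obtain ⟨b⟩ := hne
    refine le_antisymm ?_ ?_
    · rw [CategoryTheory.projectiveDimension_le_iff]
      have := hasProjectiveDimensionLT_of_isEmpty n F _ hs hz hR.exact_succ hempty
      exact CategoryTheory.hasProjectiveDimensionLT_of_ge _ n (n - 1 + 1) (by omega)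
    · rw [CategoryTheory.projectiveDimension_ge_iff]
      exact not_hasProjectiveDimensionLT (n - 1) F _ hs hz hR.exact_succ hR.minimal b
        (by rwa [Nat.sub_add_cancel hn])
  · obtain ⟨b, hb⟩ := h₃ hm hn₂
    obtain ⟨n, rfl⟩ := Nat.exists_eq_add_of_le' hn₂
    obtain ⟨m, rfl⟩ := Nat.exists_eq_add_of_le' hm
    have hbound : ∀ i (b : F.ι i), F.deg i b ≤ m + 1 + n * m + i := fun i b => by
      simpa using (h₂ i _ ⟨b, rfl⟩).2
    rw [show n + 2 - 2 = n by omega, mul_add, mul_one] at hb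
    constructor
    -- After the substitution the number of variables is `n + 2`. The element `b` of homological
    -- degree `n + 1` moves up by one when `S` is put in front, which lowers the regularity by one.
    · refine (hR.toMinimalResolutionQuotient hcc).hasRegularity hgr' ⟨⟨n + 2, b, ?_⟩, ?_⟩
      · show _ = ((F.deg (n + 1) b : ℕ) : ℤ) - ((n + 2 : ℕ) : ℤ)
        erw [hb]
        push_cast [Nat.add_sub_cancel, show n + 2 - 1 = n + 1 by omega]
        ring
      · rintro _ ⟨_ | i, b, rfl⟩
        · show ((0 : ℕ) : ℤ) - ((0 : ℕ) : ℤ) ≤ _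
          positivity
        · show ((F.deg i b : ℕ) : ℤ) - ((i + 1 : ℕ) : ℤ) ≤ _
          have := hbound i b
          rw [Nat.add_sub_cancel, show n + 2 - 1 = n + 1 by omega, add_mul, one_mul]
          omega
    · refine hR.toMinimalResolution.hasRegularity hgr ⟨⟨n + 1, b, ?_⟩, ?_⟩
      · show _ = ((F.deg (n + 1) b : ℕ) : ℤ) - ((n + 1 : ℕ) : ℤ)
        erw [hb]
        push_cast [Nat.add_sub_cancel, show n + 2 - 1 = n + 1 by omega]
        ring
      · rintro _ ⟨i, b, rfl⟩
        show ((F.deg i b : ℕ) : ℤ) - ((i : ℕ) : ℤ) ≤ _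
        have := hbound i b
        rw [Nat.add_sub_cancel, show n + 2 - 1 = n + 1 by omega, add_mul, one_mul]
        omega
  · exact ⟨lineList n m m, hR.toMinimalResolution, ⟨hJ.symm, h.pairwise⟩, h.isCone⟩
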